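/- **Notation.** Let $X$ be a topological space. Let $\mathrm D$ be the collection of all families $\mathcal U\subseteq P(X)$ with $\bigcup\mathcal U$ dense in $X$, let $\mathrm D_o$ be the collection of all $\mathcal U\in\mathrm D$ whose members are all open, and let $\mathrm O$ be the collection of all open covers of $X$. For collections $\mathcal A,\mathcal B$ of families of subsets of $X$: - $S_1(\mathcal A,\mathcal B)$: for all $\mathcal U_1,\mathcal U_2,\dots\in\mathcal A$ there are $U_n\in\mathcal U_n$ with $\{U_n : n\in\mathbb N\}\in\mathcal B$. - $S_{fin}(\mathcal A,\mathcal B)$: for all $\mathcal U_1,\mathcal U_2,\dots\in\mathcal A$ there are finite $\mathcal F_n\subseteq\mathcal U_n$ with $\bigcup_n\mathcal F_n\in\mathcal B$. The *Dense Families Diagram* has as vertices the eight properties $S(\mathrm D,\mathrm D)$, $S(\mathrm D_o,\mathrm D)$, $S(\mathrm O,\mathrm D)$, $S(\mathrm O,\mathrm O)$ with $S\in\{S_1,S_{fin}\}$, and the following eleven arrows: $S(\mathrm D,\mathrm D)\to S(\mathrm D_o,\mathrm D)\to S(\mathrm O,\mathrm D)\leftarrow S(\mathrm O,\mathrm O)$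 for each $S\in\{S_1,S_{fin}\}$; $S_1(\mathcal A,\mathcal B)\to S_{fin}(\mathcal A,\mathcal B)$ for each of the four pairs; and $S_{fin}(\mathrm D,\mathrm D)\to S_1(\mathrm O,\mathrm D)$. Let $\Omega(X)$ be the collection of all open covers $\mathcal U$ of $X$ such that $X\notin\mathcal U$ and every finite subset of $X$ is contained in a member of $\mathcal U$. The Pixley–Roy space $\mathrm{PR}(X)$ is the set of nonempty finite subsets of $X$ with the topology whose basic open sets are $[F,U]=\{H : F\subseteq H\subseteq U\}$, for $F\subseteq X$ finite and nonempty and $U\subseteq X$ open. For $X\subseteq\{0,1\}^{\mathbb N}$, the space $\mathrm{CT}(X)$ is $\{0,1\}^{<\infty}\cup\{\infty\}$, where the finite sequences are isolated and a local base at $\infty$ is given by removing $\{0,1\}^{\le k}$ and all initial segments of elements of $F$, for $k\in\mathbb N$ and finite $F\subseteq X$. **Theorem.** For any two of the eight properties $P,Q$, every nonempty topological space with property $P$ has property $Q$ if and only if $P=Q$ or $Q$ can be reached from $P$ by composing arrows of the Dense Families Diagram. Every other implication $P\to Q$ is refuted (in ZFC) by one of the following six examples, which have the stated properties: 1. The Baire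 space $\mathbb N^{\mathbb N}$ satisfies $S_1(\mathrm D,\mathrm D)$ but not $S_{fin}(\mathrm O,\mathrm O)$. 2. For every $X\subseteq\{0,1\}^{\mathbb N}$ (with the subspace topology) satisfying $S_{fin}(\Omega,\Omega)$ but not $S_1(\Omega,\Omega)$, the space $\mathrm{PR}(\mathrm{CT}(X))$ satisfies $S_{fin}(\mathrm D,\mathrm D)$ but not $S_1(\mathrm D_o,\mathrm D)$; and $X=\{0,1\}^{\mathbb N}$ is such a set. 3. For every uncountable set $X$, the Tychonoff power $\mathbb R^X$ satisfies $S_1(\mathrm D_o,\mathrm D)$ but not $S_{fin}(\mathrm D,\mathrm D)$. 4. $\mathrm{PR}(\mathbb R)$ satisfies $S_{fin}(\mathrm D_o,\mathrm D)$ but not $S_1(\mathrm O,\mathrm D)$. 5. Every uncountable successor ordinal $\alpha+1$, with the order topology, satisfies $S_1(\mathrm O,\mathrm O)$ but not $S_{fin}(\mathrm D_o,\mathrm D)$. 6. $\beta\mathbb N\setminus\mathbb N$ satisfies $S_{fin}(\mathrm O,\mathrm O)$ but not $S_1(\mathrm O,\mathrm D)$. -/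

import Mathlib

universe u

namespace DenseFamilies

/-- `S₁(𝒜, ℬ)`: from every sequence of members of `𝒜` one can select one set each so that the
selected sets form a member of `ℬ`. -/
def SOne {X : Type u} (𝒜 ℬ : Set (Set (Set X))) : Prop :=
  ∀ 𝒰 : ℕ → Set (Set X), (∀ n, 𝒰 n ∈ 𝒜) →
    ∃ U : ℕ → Set X, (∀ n, U n ∈ 𝒰 n) ∧ Set.range U ∈ ℬ

/-- `S_fin(𝒜, ℬ)`: from every sequence of members of `𝒜` one can select finitely many sets each
so that all the selected sets together form a member of `ℬ`. -/
def SFin {X : Type u} (𝒜 ℬ : Set (Set (Set X))) : Prop :=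
  ∀ 𝒰 : ℕ → Set (Set X), (∀ n, 𝒰 n ∈ 𝒜) →
    ∃ F : ℕ → Set (Set X), (∀ n, (F n).Finite ∧ F n ⊆ 𝒰 n) ∧ (⋃ n, F n) ∈ ℬ

/-- `D`: the families of arbitrary subsets of `X` whose union is dense. -/
def D (X : Type u) [TopologicalSpace X] : Set (Set (Set X)) :=
  {𝒰 | Dense (⋃₀ 𝒰)}

/-- `D_o`: the families of open subsets of `X` whose union is dense. -/
def Do (X : Type u) [TopologicalSpace X] : Set (Set (Set X)) :=
  {𝒰 | Dense (⋃₀ 𝒰) ∧ ∀ U ∈ 𝒰, IsOpen U}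

/-- `O`: the open covers of `X`. -/
def Op (X : Type u) [TopologicalSpace X] : Set (Set (Set X)) :=
  {𝒰 | ⋃₀ 𝒰 = Set.univ ∧ ∀ U ∈ 𝒰, IsOpen U}

/-- `Ω`: the open covers of `X` that do not contain `X` itself and such that every finite subset
of `X` is contained in some member of the cover. -/
def Omega (X : Type u) [TopologicalSpace X] : Set (Set (Set X)) :=
  {𝒰 | 𝒰 ∈ Op X ∧ Set.univ ∉ 𝒰 ∧ ∀ G : Set X, G.Finite → ∃ U ∈ 𝒰, G ⊆ U}

/-- Names of the eight properties in the diagram. -/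
inductive SelProp : Type
  | finDD | finDoD | finOpD | finOpOp
  | oneDD | oneDoD | oneOpD | oneOpOp

/-- The meaning of the eight names: the space `X` has the named property. -/
def SelProp.Holds (X : Type u) [TopologicalSpace X] : SelProp → Prop
  | .finDD => SFin (D X) (D X)
  | .finDoD => SFin (Do X) (D X)
  | .finOpD => SFin (Op X) (D X)
  | .finOpOp => SFin (Op X) (Op X)
  | .oneDD => SOne (D X) (D X)
  | .oneDoD => SOne (Do X) (D X)
  | .oneOpD => SOne (Op X) (D X)
  | .oneOpOp => SOne (Op X) (Op X)

/-- The eleven arrows of the Dense Families Diagram. -/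
inductive Arrow : SelProp → SelProp → Prop
  | finDD_finDoD : Arrow .finDD .finDoD
  | finDoD_finOpD : Arrow .finDoD .finOpD
  | finOpOp_finOpD : Arrow .finOpOp .finOpD
  | oneDD_oneDoD : Arrow .oneDD .oneDoD
  | oneDoD_oneOpD : Arrow .oneDoD .oneOpD
  | oneOpOp_oneOpD : Arrow .oneOpOp .oneOpD
  | oneDD_finDD : Arrow .oneDD .finDD
  | oneDoD_finDoD : Arrow .oneDoD .finDoD
  | oneOpD_finOpD : Arrow .oneOpD .finOpD
  | oneOpOp_finOpOp : Arrow .oneOpOp .finOpOp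
  | finDD_oneOpD : Arrow .finDD .oneOpD

/-- `Q` is reached from `P` by composing (zero or more) arrows of the diagram. -/
def Reaches (P Q : SelProp) : Prop := Relation.ReflTransGen Arrow P Q

/-- The space `X` refutes the implication `P → Q`. -/
def Refutes (X : Type u) [TopologicalSpace X] (P Q : SelProp) : Prop :=
  P.Holds X ∧ ¬ Q.Holds X

/-- The points of the Pixley–Roy space `PR(X)`: the nonempty finite subsets of `X`. -/
def PixleyRoy (X : Type u) : Type u := {F : Finset X // F.Nonempty}

/-- The basic open set `[F, U] = {H ∈ PR(X) : F ⊆ H ⊆ U}`. -/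
def PixleyRoy.basic {X : Type u} (F : PixleyRoy X) (U : Set X) : Set (PixleyRoy X) :=
  {H | F.1 ⊆ H.1 ∧ (H.1 : Set X) ⊆ U}

instance PixleyRoy.instTopologicalSpace (X : Type u) [TopologicalSpace X] :
    TopologicalSpace (PixleyRoy X) :=
  TopologicalSpace.generateFrom
    {B | ∃ (F : PixleyRoy X) (U : Set X), IsOpen U ∧ B = PixleyRoy.basic F U}

/-- The points of the Cantor tree space `CT(X)`, for a set `X` of infinite binary sequences: the
finite binary sequences together with one further point `infty`. (The set `X` enters through the
topology.) -/
inductive CantorTree (X : Set (ℕ → Bool)) : Type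
  | node (s : List Bool) : CantorTree X
  | infty : CantorTree X

/-- The infinite sequence `f` extends the finite sequence `s`. -/
def Extends (f : ℕ → Bool) (s : List Bool) : Prop :=
  ∀ (i : ℕ) (h : i < s.length), s[i] = f i

/-- The basic neighbourhood of `infty` given by `k` and `F`: remove all finite sequences of length
at most `k` and all finite sequences that are extended by an element of `F`. -/
def CantorTree.basic (X : Set (ℕ → Bool)) (k : ℕ) (F : Set (ℕ → Bool)) : Set (CantorTree X) :=
  {p | ∀ s : List Bool, p = .node s → ¬ (s.length ≤ k ∨ ∃ f ∈ F, Extends f s)}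

/-- The finite sequences are isolated, and the sets `CantorTree.basic X k F`, for `k ∈ ℕ` and
finite `F ⊆ X`, form a local base at `infty`. -/
instance CantorTree.instTopologicalSpace (X : Set (ℕ → Bool)) :
    TopologicalSpace (CantorTree X) where
  IsOpen U := .infty ∈ U →
    ∃ (k : ℕ) (F : Set (ℕ → Bool)), F.Finite ∧ F ⊆ X ∧ CantorTree.basic X k F ⊆ U
  isOpen_univ := fun _ => ⟨0, ∅, Set.finite_empty, Set.empty_subset _, Set.subset_univ _⟩
  isOpen_inter := by
    rintro U V hU hV ⟨h1, h2⟩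
    obtain ⟨k, F, hF, hFX, hk⟩ := hU h1
    obtain ⟨l, G, hG, hGX, hl⟩ := hV h2
    refine ⟨max k l, F ∪ G, hF.union hG, Set.union_subset hFX hGX, fun p hp => ⟨?_, ?_⟩⟩
    · refine hk fun s hs hbad => hp s hs ?_
      rcases hbad with h | ⟨f, hf, hfs⟩
      · exact Or.inl (h.trans (le_max_left _ _))
      · exact Or.inr ⟨f, Or.inl hf, hfs⟩
    · refine hl fun s hs hbad => hp s hs ?_
      rcases hbad with h | ⟨f, hf, hfs⟩
      · exact Or.inl (h.trans (le_max_right _ _))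
      · exact Or.inr ⟨f, Or.inr hf, hfs⟩
  isOpen_sUnion := by
    rintro 𝒮 h ⟨U, hU, hmem⟩
    obtain ⟨k, F, hF, hFX, hk⟩ := h U hU hmem
    exact ⟨k, F, hF, hFX, hk.trans (Set.subset_sUnion_of_mem hU)⟩

/-- The remainder `βℕ ∖ ℕ`: the space `βℕ` is the space of ultrafilters on `ℕ`, in which the
natural numbers are the principal ultrafilters. -/
abbrev BetaNRemainder : Type :=
  ↥((Set.range (pure : ℕ → Ultrafilter ℕ))ᶜ : Set (Ultrafilter ℕ))

end DenseFamilies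

namespace DenseFamilies

open Set Topology

/-! ### Selection principles and the diagram -/

section General

variable {X : Type*}

/-! All arrows but one follow from `O ⊆ D_o ⊆ D` or from selecting one-element sets. The exception,
`S_fin(D, D) → S₁(O, D)`, passes through separability: `S_fin(D, D)` applied to the family of
singletons yields a countable dense set, and the n-th cover then only has to catch its n-th point.

For completeness, a space refuting `P₀ → Q₀` also refutes `P → Q` whenever `P₀` reaches `P` and `Q`
reaches `Q₀`. A finite check (`exists_separated_of_not_reaches`) reduces every missing implication
to the six pairs of `Separated`, one for each example.

The positive halves rest on a countable base (Baire space), a countable set of coordinates closed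
under all choices (real powers), well-founded induction (ordinals), compactness (`βℕ ∖ ℕ`, and
compact sets of tuples for `PR(ℝ)`), and a translation of dense sets in `PR(CT(X))` into members of
`Ω(X)`. The negative halves use diagonalization, countability of the selection, or open sets of
small measure; for `PR(CT(X))` the translation is run backwards. -/

theorem SOne.mono {𝒜 𝒜' ℬ ℬ' : Set (Set (Set X))} (h𝒜 : 𝒜' ⊆ 𝒜) (hℬ : ℬ ⊆ ℬ')
    (h : SOne 𝒜 ℬ) : SOne 𝒜' ℬ' := fun 𝒰 h𝒰 =>
  let ⟨U, hU, hUℬ⟩ := h 𝒰 fun n => h𝒜 (h𝒰 n)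
  ⟨U, hU, hℬ hUℬ⟩

theorem SFin.mono {𝒜 𝒜' ℬ ℬ' : Set (Set (Set X))} (h𝒜 : 𝒜' ⊆ 𝒜) (hℬ : ℬ ⊆ ℬ')
    (h : SFin 𝒜 ℬ) : SFin 𝒜' ℬ' := fun 𝒰 h𝒰 =>
  let ⟨F, hF, hFℬ⟩ := h 𝒰 fun n => h𝒜 (h𝒰 n)
  ⟨F, hF, hℬ hFℬ⟩

theorem SOne.sFin {𝒜 ℬ : Set (Set (Set X))} (h : SOne 𝒜 ℬ) : SFin 𝒜 ℬ := fun 𝒰 h𝒰 => by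
  obtain ⟨U, hU, hUℬ⟩ := h 𝒰 h𝒰
  refine ⟨fun n => {U n}, fun n => ⟨finite_singleton _, by simpa using hU n⟩, ?_⟩
  rwa [iUnion_singleton_eq_range]

variable [TopologicalSpace X]

theorem Do_subset_D : Do X ⊆ D X := fun _ h => h.1

theorem Op_subset_Do : Op X ⊆ Do X := fun 𝒰 h => ⟨by rw [h.1]; exact dense_univ, h.2⟩

theorem Op_subset_D : Op X ⊆ D X := Op_subset_Do.trans Do_subset_D

theorem nonempty_of_mem_D [Nonempty X] {𝒰 : Set (Set X)} (h : 𝒰 ∈ D X) : 𝒰.Nonempty := by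
  obtain ⟨x, U, hU, -⟩ := Dense.nonempty (show Dense (⋃₀ 𝒰) from h)
  exact ⟨U, hU⟩

/-- `S_fin(D, D)` gives each dense set a dense countable subset. -/
theorem SFin.exists_countable_dense_subset (h : SFin (D X) (D X)) {A : Set X} (hA : Dense A) :
    ∃ C ⊆ A, C.Countable ∧ Dense C := by
  -- With the singletons of points of `A` as the family, a finite selection is a finite subset of
  -- `A`.
  obtain ⟨F, hF, hd⟩ := h (fun _ => (fun x : X => ({x} : Set X)) '' A) fun _ => by
    simpa [D, sUnion_image] using hA
  have hsub : ⋃ n, F n ⊆ (fun x : X => ({x} : Set X)) '' A := iUnion_subset fun n => (hF n).2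
  refine ⟨⋃₀ ⋃ n, F n, ?_, ?_, hd⟩
  · rintro x ⟨U, hU, hx⟩
    obtain ⟨y, hy, rfl⟩ := hsub hU
    rwa [mem_singleton_iff.1 hx]
  · refine (countable_iUnion fun n => (hF n).1.countable).sUnion fun U hU => ?_
    obtain ⟨y, -, rfl⟩ := hsub hU
    exact countable_singleton y

theorem sOne_Op_D_of_separable [TopologicalSpace.SeparableSpace X] [Nonempty X] : SOne (Op X) (D X) := by
  intro 𝒰 h𝒰
  have key : ∀ n, ∃ U ∈ 𝒰 n, TopologicalSpace.denseSeq X n ∈ U := fun n => by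
    have : TopologicalSpace.denseSeq X n ∈ ⋃₀ 𝒰 n := by rw [(h𝒰 n).1]; trivial
    exact this
  choose U hU hmem using key
  refine ⟨U, hU, (TopologicalSpace.denseRange_denseSeq X).mono ?_⟩
  rintro _ ⟨n, rfl⟩
  exact ⟨U n, ⟨n, rfl⟩, hmem n⟩

theorem SFin.sOne_Op_D [Nonempty X] (h : SFin (D X) (D X)) : SOne (Op X) (D X) := by
  obtain ⟨C, -, hC, hd⟩ := h.exists_countable_dense_subset dense_univ
  have : TopologicalSpace.SeparableSpace X := ⟨C, hC, hd⟩
  exact sOne_Op_D_of_separable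

/-- To verify `S_fin(D, D)` it is enough to select points from dense sets. -/
theorem sFin_D_D_of_forall_dense
    (h : ∀ A : ℕ → Set X, (∀ n, Dense (A n)) →
      ∃ E : ℕ → Set X, (∀ n, (E n).Finite ∧ E n ⊆ A n) ∧ Dense (⋃ n, E n)) :
    SFin (D X) (D X) := by
  intro 𝒰 h𝒰
  obtain ⟨E, hE, hd⟩ := h (fun n => ⋃₀ 𝒰 n) h𝒰
  choose! U hU hmem using fun n x (hx : x ∈ E n) => (hE n).2 hx
  refine ⟨fun n => U n '' E n, fun n => ⟨(hE n).1.image _, ?_⟩, hd.mono ?_⟩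
  · rintro _ ⟨x, hx, rfl⟩
    exact hU n x hx
  · refine iUnion_subset fun n x hx => ⟨U n x, mem_iUnion.2 ⟨n, x, hx, rfl⟩, hmem n x hx⟩

/-- In a countable space `S_fin(D, D)` can be verified one point at a time. -/
theorem sFin_D_D_of_countable [Countable X] [Nonempty X]
    (h : ∀ (x : X) (A : ℕ → Set X), (∀ n, Dense (A n)) →
      ∃ E : ℕ → Set X, (∀ n, (E n).Finite ∧ E n ⊆ A n) ∧ x ∈ closure (⋃ n, E n)) :
    SFin (D X) (D X) := by
  refine sFin_D_D_of_forall_dense fun A hA => ?_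
  obtain ⟨p, hp⟩ := exists_surjective_nat X
  -- The pairing function splits the sequence into infinitely many subsequences; the i-th one takes
  -- care of the point `p i`.
  choose E hE hmem using fun i => h (p i) (fun j => A (Nat.pair i j)) fun j => hA _
  refine ⟨fun n => E n.unpair.1 n.unpair.2, fun n => ?_, fun x => ?_⟩
  · simpa using hE n.unpair.1 n.unpair.2
  · obtain ⟨i, rfl⟩ := hp x
    refine closure_mono (iUnion_subset fun j => ?_) (hmem i)
    exact subset_iUnion_of_subset (Nat.pair i j) (by simp)

theorem sFin_Op_Op_of_compact [CompactSpace X] : SFin (Op X) (Op X) := by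
  intro 𝒰 h𝒰
  have key : ∀ n, ∃ F : Set (Set X), F.Finite ∧ F ⊆ 𝒰 n ∧ ⋃₀ F = univ := fun n => by
    obtain ⟨T, hT⟩ := isCompact_univ.elim_finite_subcover (fun U : 𝒰 n => (U : Set X))
      (fun U => (h𝒰 n).2 U U.2) (by rw [← sUnion_eq_iUnion, (h𝒰 n).1])
    refine ⟨Subtype.val '' (T : Set (𝒰 n)), T.finite_toSet.image _, ?_, ?_⟩
    · rintro _ ⟨U, -, rfl⟩
      exact U.2
    · rw [sUnion_image]
      exact univ_subset_iff.1 hT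
  choose F hfin hsub hcov using key
  refine ⟨F, fun n => ⟨hfin n, hsub n⟩, ?_, ?_⟩
  · refine univ_subset_iff.1 ?_
    rw [← hcov 0]
    exact sUnion_subset_sUnion (subset_iUnion F 0)
  · rintro U hU
    obtain ⟨n, hn⟩ := mem_iUnion.1 hU
    exact (h𝒰 n).2 U (hsub n hn)

end General

/-! ### Invariance under homeomorphisms -/

section Invariance

universe v
variable {X : Type u} {Y : Type v}

theorem SOne.transfer {𝒜 ℬ : Set (Set (Set X))} {𝒜' ℬ' : Set (Set (Set Y))}
    (e : X ≃ Y) (h𝒜 : ∀ 𝒰 ∈ 𝒜', preimage e '' 𝒰 ∈ 𝒜)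
    (hℬ : ∀ 𝒰 ∈ ℬ, preimage e.symm '' 𝒰 ∈ ℬ') (h : SOne 𝒜 ℬ) : SOne 𝒜' ℬ' := by
  intro 𝒰 h𝒰
  obtain ⟨U, hU, hUB⟩ := h (fun n => preimage e '' 𝒰 n) fun n => h𝒜 _ (h𝒰 n)
  refine ⟨fun n => e.symm ⁻¹' U n, fun n => ?_, ?_⟩
  · obtain ⟨V, hV, hVU⟩ := hU n
    simpa [← hVU, ← preimage_comp] using hV
  · have := hℬ _ hUB
    rwa [← range_comp] at this

theorem SFin.transfer {𝒜 ℬ : Set (Set (Set X))} {𝒜' ℬ' : Set (Set (Set Y))}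
    (e : X ≃ Y) (h𝒜 : ∀ 𝒰 ∈ 𝒜', preimage e '' 𝒰 ∈ 𝒜)
    (hℬ : ∀ 𝒰 ∈ ℬ, preimage e.symm '' 𝒰 ∈ ℬ') (h : SFin 𝒜 ℬ) : SFin 𝒜' ℬ' := by
  intro 𝒰 h𝒰
  obtain ⟨F, hF, hFB⟩ := h (fun n => preimage e '' 𝒰 n) fun n => h𝒜 _ (h𝒰 n)
  refine ⟨fun n => preimage e.symm '' F n, fun n => ⟨(hF n).1.image _, ?_⟩, ?_⟩
  · rintro _ ⟨V, hV, rfl⟩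
    obtain ⟨W, hW, rfl⟩ := (hF n).2 hV
    simpa [← preimage_comp] using hW
  · have := hℬ _ hFB
    rwa [image_iUnion] at this

theorem sUnion_preimage_image (f : X → Y) (𝒰 : Set (Set Y)) :
    ⋃₀ (preimage f '' 𝒰) = f ⁻¹' ⋃₀ 𝒰 := by
  rw [sUnion_image, preimage_sUnion]

variable [TopologicalSpace X] [TopologicalSpace Y]

theorem preimage_image_mem_D (e : X ≃ₜ Y) {𝒰 : Set (Set Y)} (h : 𝒰 ∈ D Y) :
    preimage e '' 𝒰 ∈ D X := by
  simp only [D, mem_ofPred_eq, sUnion_preimage_image] at *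
  exact h.preimage e.isOpenMap

theorem isOpen_of_mem_preimage_image (e : X ≃ₜ Y) {𝒰 : Set (Set Y)} (h : ∀ U ∈ 𝒰, IsOpen U) :
    ∀ U ∈ preimage e '' 𝒰, IsOpen U := by
  rintro _ ⟨U, hU, rfl⟩
  exact (h U hU).preimage e.continuous

theorem preimage_image_mem_Do (e : X ≃ₜ Y) {𝒰 : Set (Set Y)} (h : 𝒰 ∈ Do Y) :
    preimage e '' 𝒰 ∈ Do X :=
  ⟨preimage_image_mem_D e h.1, isOpen_of_mem_preimage_image e h.2⟩

theorem preimage_image_mem_Op (e : X ≃ₜ Y) {𝒰 : Set (Set Y)} (h : 𝒰 ∈ Op Y) :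
    preimage e '' 𝒰 ∈ Op X :=
  ⟨by rw [sUnion_preimage_image, h.1, preimage_univ], isOpen_of_mem_preimage_image e h.2⟩

theorem SelProp.Holds.of_homeomorph (e : X ≃ₜ Y) {P : SelProp} (h : P.Holds X) : P.Holds Y := by
  cases P
  · exact SFin.transfer e.toEquiv (fun _ => preimage_image_mem_D e)
      (fun _ => preimage_image_mem_D e.symm) h
  · exact SFin.transfer e.toEquiv (fun _ => preimage_image_mem_Do e)
      (fun _ => preimage_image_mem_D e.symm) h
  · exact SFin.transfer e.toEquiv (fun _ => preimage_image_mem_Op e)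
      (fun _ => preimage_image_mem_D e.symm) h
  · exact SFin.transfer e.toEquiv (fun _ => preimage_image_mem_Op e)
      (fun _ => preimage_image_mem_Op e.symm) h
  · exact SOne.transfer e.toEquiv (fun _ => preimage_image_mem_D e)
      (fun _ => preimage_image_mem_D e.symm) h
  · exact SOne.transfer e.toEquiv (fun _ => preimage_image_mem_Do e)
      (fun _ => preimage_image_mem_D e.symm) h
  · exact SOne.transfer e.toEquiv (fun _ => preimage_image_mem_Op e)
      (fun _ => preimage_image_mem_D e.symm) h
  · exact SOne.transfer e.toEquiv (fun _ => preimage_image_mem_Op e)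
      (fun _ => preimage_image_mem_Op e.symm) h

theorem Refutes.of_homeomorph (e : X ≃ₜ Y) {P Q : SelProp} (h : Refutes X P Q) :
    Refutes Y P Q :=
  ⟨h.1.of_homeomorph e, fun hQ => h.2 (hQ.of_homeomorph e.symm)⟩

end Invariance

/-! ### Validity of the arrows and reduction to six non-implications -/

section Diagram

variable {X : Type u} [TopologicalSpace X]

theorem Arrow.holds [Nonempty X] {P Q : SelProp} (h : Arrow P Q) (hP : P.Holds X) :
    Q.Holds X := by
  cases h
  · exact SFin.mono Do_subset_D subset_rfl hP
  · exact SFin.mono Op_subset_Do subset_rfl hP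
  · exact SFin.mono subset_rfl Op_subset_D hP
  · exact SOne.mono Do_subset_D subset_rfl hP
  · exact SOne.mono Op_subset_Do subset_rfl hP
  · exact SOne.mono subset_rfl Op_subset_D hP
  · exact SOne.sFin hP
  · exact SOne.sFin hP
  · exact SOne.sFin hP
  · exact SOne.sFin hP
  · exact SFin.sOne_Op_D hP

theorem Reaches.holds [Nonempty X] {P Q : SelProp} (h : Reaches P Q) (hP : P.Holds X) :
    Q.Holds X := by
  induction h with
  | refl => exact hP
  | tail _ hbc ih => exact hbc.holds ih

theorem Refutes.of_reaches [Nonempty X] {P₀ Q₀ P Q : SelProp} (h : Refutes X P₀ Q₀)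
    (hP : Reaches P₀ P) (hQ : Reaches Q Q₀) : Refutes X P Q :=
  ⟨hP.holds h.1, fun hh => h.2 (hQ.holds hh)⟩

/-- The six non-implications exhibited by the examples. -/
inductive Separated : SelProp → SelProp → Prop
  | oneDD_finOpOp : Separated .oneDD .finOpOp
  | finDD_oneDoD : Separated .finDD .oneDoD
  | oneDoD_finDD : Separated .oneDoD .finDD
  | finDoD_oneOpD : Separated .finDoD .oneOpD
  | oneOpOp_finDoD : Separated .oneOpOp .finDoD
  | finOpOp_oneOpD : Separated .finOpOp .oneOpD

/-- The properties that the diagram derives from a given one. -/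
def SelProp.consequences : SelProp → List SelProp
  | .finDD => [.finDD, .finDoD, .finOpD, .oneOpD]
  | .finDoD => [.finDoD, .finOpD]
  | .finOpD => [.finOpD]
  | .finOpOp => [.finOpOp, .finOpD]
  | .oneDD => [.oneDD, .oneDoD, .oneOpD, .finDD, .finDoD, .finOpD]
  | .oneDoD => [.oneDoD, .oneOpD, .finDoD, .finOpD]
  | .oneOpD => [.oneOpD, .finOpD]
  | .oneOpOp => [.oneOpOp, .oneOpD, .finOpOp, .finOpD]

theorem reaches_of_mem_consequences {P Q : SelProp} (h : Q ∈ P.consequences) : Reaches P Q := by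
  have one : ∀ {P Q}, Arrow P Q → Reaches P Q := fun h => Relation.ReflTransGen.single h
  have two : ∀ {P Q R}, Arrow P Q → Arrow Q R → Reaches P R := fun h h' => (one h).tail h'
  cases P <;> cases Q <;>
    first
      | exact Relation.ReflTransGen.refl
      | (simp [SelProp.consequences] at h; done)
      | exact one (by constructor)
      | exact two .finDD_finDoD .finDoD_finOpD
      | exact two .oneDD_oneDoD .oneDoD_oneOpD
      | exact two .oneDD_finDD .finDD_finDoD
      | exact (two .oneDD_finDD .finDD_finDoD).tail .finDoD_finOpD
      | exact two .oneDoD_oneOpD .oneOpD_finOpD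
      | exact two .oneDoD_finDoD .finDoD_finOpD
      | exact two .oneOpOp_oneOpD .oneOpD_finOpD

/-- Because everything listed in `SelProp.consequences` is reachable, the claim becomes a check of
list membership for the 64 pairs. That the lists are exhaustive is not needed. -/
theorem exists_separated_of_not_reaches {P Q : SelProp} (h : ¬ Reaches P Q) :
    ∃ P₀ Q₀, Separated P₀ Q₀ ∧ Reaches P₀ P ∧ Reaches Q Q₀ := by
  have h' : Q ∉ P.consequences := fun hh => h (reaches_of_mem_consequences hh)
  suffices H : ∃ P₀ Q₀, Separated P₀ Q₀ ∧ P ∈ P₀.consequences ∧ Q₀ ∈ Q.consequences by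
    obtain ⟨P₀, Q₀, hs, hP, hQ⟩ := H
    exact ⟨P₀, Q₀, hs, reaches_of_mem_consequences hP, reaches_of_mem_consequences hQ⟩
  cases P <;> cases Q <;>
    first
      | (simp [SelProp.consequences] at h'; done)
      | (refine ⟨_, _, .oneDD_finOpOp, ?_, ?_⟩ <;> simp [SelProp.consequences] <;> done)
      | (refine ⟨_, _, .finDD_oneDoD, ?_, ?_⟩ <;> simp [SelProp.consequences] <;> done)
      | (refine ⟨_, _, .oneDoD_finDD, ?_, ?_⟩ <;> simp [SelProp.consequences] <;> done)
      | (refine ⟨_, _, .finDoD_oneOpD, ?_, ?_⟩ <;> simp [SelProp.consequences] <;> done)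
      | (refine ⟨_, _, .oneOpOp_finDoD, ?_, ?_⟩ <;> simp [SelProp.consequences] <;> done)
      | (refine ⟨_, _, .finOpOp_oneOpD, ?_, ?_⟩ <;> simp [SelProp.consequences])

end Diagram

end DenseFamilies

namespace DenseFamilies

open Set Topology Filter

/-! ### The Baire space -/

/-- The n-th choice only has to meet the n-th basic open set. -/
theorem sOne_D_D_of_secondCountable {X : Type*} [TopologicalSpace X]
    [SecondCountableTopology X] [Nonempty X] : SOne (D X) (D X) := by
  intro 𝒰 h𝒰
  have hb := TopologicalSpace.isBasis_countableBasis X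
  obtain ⟨B, hB⟩ := (TopologicalSpace.countable_countableBasis X).exists_eq_range
    (by
      obtain ⟨x⟩ := ‹Nonempty X›
      obtain ⟨V, hV, -⟩ := hb.exists_subset_of_mem_open (mem_univ x) isOpen_univ
      exact ⟨V, hV⟩)
  have hmem : ∀ n, B n ∈ TopologicalSpace.countableBasis X := fun n => hB ▸ mem_range_self n
  have key : ∀ n, ∃ U ∈ 𝒰 n, (B n ∩ U).Nonempty := fun n => by
    obtain ⟨x, hx, U, hU, hxU⟩ := (show Dense (⋃₀ 𝒰 n) from h𝒰 n).inter_open_nonempty _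
      (hb.isOpen (hmem n)) (TopologicalSpace.nonempty_of_mem_countableBasis (hmem n))
    exact ⟨U, hU, x, hx, hxU⟩
  choose U hU hne using key
  refine ⟨U, hU, hb.dense_iff.2 fun V hV _ => ?_⟩
  obtain ⟨n, rfl⟩ := hB ▸ hV
  obtain ⟨x, hx, hxU⟩ := hne n
  exact ⟨x, hx, U n, ⟨n, rfl⟩, hxU⟩

/-- The n-th coordinate partitions the space into infinitely many open pieces. A finite selection
omits the piece of some value `g n`, and the resulting `g` stays uncovered. -/
theorem not_sFin_Op_Op_baire : ¬ SFin (Op (ℕ → ℕ)) (Op (ℕ → ℕ)) := by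
  intro h
  obtain ⟨F, hF, hc, -⟩ := h (fun n => range fun k => {f : ℕ → ℕ | f n = k}) fun n => by
    refine ⟨eq_univ_of_forall fun f => ⟨_, ⟨f n, rfl⟩, rfl⟩, ?_⟩
    rintro _ ⟨k, rfl⟩
    change IsOpen ((fun f : ℕ → ℕ => f n) ⁻¹' {k})
    exact (isOpen_discrete _).preimage (continuous_apply n)
  have key : ∀ n, ∃ k : ℕ, {f : ℕ → ℕ | f n = k} ∉ F n := fun n => by
    by_contra! hall
    refine infinite_range_of_injective (f := fun k => {f : ℕ → ℕ | f n = k}) (fun k l hkl => ?_)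
      ((hF n).1.subset (range_subset_iff.2 hall))
    exact (Set.ext_iff.1 hkl fun _ => k).1 rfl
  choose g hg using key
  obtain ⟨V, hV, hgV⟩ : g ∈ ⋃₀ ⋃ n, F n := hc ▸ mem_univ g
  obtain ⟨n, hn⟩ := mem_iUnion.1 hV
  obtain ⟨k, rfl⟩ := (hF n).2 hn
  have hk : g n = k := hgV
  exact hg n (hk ▸ hn)

theorem refutes_baire : Refutes (ℕ → ℕ) .oneDD .finOpOp :=
  ⟨sOne_D_D_of_secondCountable, not_sFin_Op_Op_baire⟩

/-! ### Powers of the real line -/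

section RealPower

variable {X : Type u}

/-- The open box given by finitely many rational constraints `q < f x < r`. -/
def ratBox (T : Finset (X × ℚ × ℚ)) : Set (X → ℝ) :=
  {f | ∀ p ∈ T, (p.2.1 : ℝ) < f p.1 ∧ f p.1 < p.2.2}

theorem exists_ratBox_subset {O : Set (X → ℝ)} (hO : IsOpen O) {f : X → ℝ} (hf : f ∈ O) :
    ∃ T, f ∈ ratBox T ∧ ratBox T ⊆ O := by
  classical
  obtain ⟨I, u, hu, hsub⟩ := isOpen_pi_iff.1 hO f hf
  have key : ∀ a, ∃ q r : ℚ, a ∈ I → (q : ℝ) < f a ∧ f a < r ∧ Ioo (q : ℝ) r ⊆ u a := fun a => by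
    by_cases ha : a ∈ I
    · obtain ⟨l, m, ⟨hl, hm⟩, hlm⟩ :=
        mem_nhds_iff_exists_Ioo_subset.1 ((hu a ha).1.mem_nhds (hu a ha).2)
      obtain ⟨q, hlq, hq⟩ := exists_rat_btwn hl
      obtain ⟨r, hr, hrm⟩ := exists_rat_btwn hm
      exact ⟨q, r, fun _ => ⟨hq, hr, (Ioo_subset_Ioo hlq.le hrm.le).trans hlm⟩⟩
    · exact ⟨0, 0, fun h => absurd h ha⟩
  choose q r hqr using key
  refine ⟨I.image fun a => (a, q a, r a), fun p hp => ?_, fun g hg => hsub fun a ha => ?_⟩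
  · obtain ⟨a, ha, rfl⟩ := Finset.mem_image.1 hp
    exact ⟨(hqr a ha).1, (hqr a ha).2.1⟩
  · exact (hqr a ha).2.2 (hg (a, q a, r a) (Finset.mem_image_of_mem _ ha))

theorem countable_finset_subset {Y : Type*} {A : Set Y} (hA : A.Countable) :
    {T : Finset Y | ↑T ⊆ A}.Countable :=
  ((countable_ofPred_finite_subset hA).preimage_of_injOn
    (f := fun T : Finset Y => (T : Set Y)) Finset.coe_injective.injOn).mono
    fun T hT => And.intro T.finite_toSet hT

/-- A countable-valued operation on finite sets has a countable closed set. -/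
theorem exists_countable_closed_under {Y : Type*} (φ : Finset Y → Set Y)
    (hφ : ∀ T, (φ T).Countable) :
    ∃ A : Set Y, A.Countable ∧ ∀ T : Finset Y, ↑T ⊆ A → φ T ⊆ A := by
  let step : Set Y → Set Y := fun A => A ∪ ⋃ T ∈ {T : Finset Y | ↑T ⊆ A}, φ T
  let S : ℕ → Set Y := fun n => step^[n] ∅
  have hS : ∀ n, S (n + 1) = step (S n) := fun n => Function.iterate_succ_apply' step n ∅
  have hmono : Monotone S := monotone_nat_of_le_succ fun n => by
    rw [hS]
    exact subset_union_left
  have hcount : ∀ n, (S n).Countable := fun n => by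
    induction n with
    | zero => exact countable_empty
    | succ n ih =>
      rw [hS]
      exact ih.union ((countable_finset_subset ih).biUnion fun T _ => hφ T)
  refine ⟨⋃ n, S n, countable_iUnion hcount, fun T hT => ?_⟩
  have key : ∃ n, (T : Set Y) ⊆ S n := by
    choose! i hi using fun x (hx : x ∈ T) => mem_iUnion.1 (hT hx)
    exact ⟨T.sup i, fun x hx => hmono (Finset.le_sup (f := i) hx) (hi x hx)⟩
  obtain ⟨n, hn⟩ := key
  refine subset_iUnion_of_subset (n + 1) ?_
  rw [hS]
  exact subset_union_of_subset_right (subset_biUnion_of_mem (u := φ) hn) _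

/-- Each nonempty box `T` gets, for each `n`, a smaller box `T' T n` inside a member of `𝒰 n`. Some
countable `A ⊆ X` is such that boxes over `A` have answers over `A`; the n-th choice answers the
n-th box over `A`. For an arbitrary box, answer its part over `A`: the answer leaves the coordinates
outside `A` free, so it is compatible with the remaining constraints. -/
theorem sOne_Do_D_real_power : SOne (Do (X → ℝ)) (D (X → ℝ)) := by
  classical
  intro 𝒰 h𝒰
  have key : ∀ (T : Finset (X × ℚ × ℚ)) (n : ℕ), ∃ U ∈ 𝒰 n, ∃ T',
      (ratBox T).Nonempty → (ratBox T').Nonempty ∧ ratBox T' ⊆ U ∩ ratBox T := by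
    intro T n
    by_cases hT : (ratBox T).Nonempty
    · have hopen : IsOpen (ratBox T) := by
        have : ratBox T = ⋂ p ∈ T, (fun f : X → ℝ => f p.1) ⁻¹' Ioo (p.2.1 : ℝ) p.2.2 := by
          ext f
          simp [ratBox]
        rw [this]
        exact isOpen_biInter_finset fun p _ => isOpen_Ioo.preimage (continuous_apply p.1)
      obtain ⟨f, hf, U, hU, hfU⟩ := (h𝒰 n).1.inter_open_nonempty _ hopen hT
      obtain ⟨T', hfT', hT'⟩ := exists_ratBox_subset (((h𝒰 n).2 U hU).inter hopen) ⟨hfU, hf⟩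
      exact ⟨U, hU, T', fun _ => ⟨⟨f, hfT'⟩, hT'⟩⟩
    · obtain ⟨U, hU⟩ := nonempty_of_mem_D (h𝒰 n).1
      -- Dummy values: an empty box needs no answer.
      exact ⟨U, hU, ∅, fun h => absurd h hT⟩
  choose U hU T' hT' using key
  obtain ⟨A, hA, hclosed⟩ := exists_countable_closed_under
    (fun E : Finset X => ⋃ T ∈ {T : Finset (X × ℚ × ℚ) | (T : Set (X × ℚ × ℚ)) ⊆ (E : Set X) ×ˢ univ},
      ⋃ n, Prod.fst '' (T' T n : Set (X × ℚ × ℚ))) fun E => by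
      refine (countable_finset_subset ?_).biUnion fun T _ => countable_iUnion fun n =>
        ((T' T n).finite_toSet.image _).countable
      exact E.finite_toSet.countable.prod countable_univ
  have hsupp : ∀ T : Finset (X × ℚ × ℚ), ↑T ⊆ A ×ˢ (univ : Set (ℚ × ℚ)) → ∀ n, ∀ p ∈ T' T n,
      p.1 ∈ A := by
    intro T hT n p hp
    refine hclosed (T.image Prod.fst) ?_ (mem_biUnion (x := T) ?_ (mem_iUnion.2 ⟨n, p, hp, rfl⟩))
    · intro x hx
      obtain ⟨p, hp, rfl⟩ := Finset.mem_image.1 hx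
      exact (hT hp).1
    · exact fun p hp => ⟨Finset.mem_image_of_mem _ hp, mem_univ _⟩
  obtain ⟨B, hB⟩ := (countable_finset_subset
    (hA.prod (countable_univ (α := ℚ × ℚ)))).exists_eq_range ⟨∅, by simp⟩
  refine ⟨fun n => U (B n) n, fun n => hU _ _, dense_iff_inter_open.2 ?_⟩
  rintro O hO ⟨f, hf⟩
  obtain ⟨T, hfT, hTO⟩ := exists_ratBox_subset hO hf
  obtain ⟨n, hn⟩ : T.filter (fun p => p.1 ∈ A) ∈ range B := by
    rw [← hB]
    exact fun p hp => ⟨(Finset.mem_filter.1 hp).2, mem_univ _⟩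
  have hBn : (B n : Set (X × ℚ × ℚ)) ⊆ A ×ˢ univ := hB.ge (mem_range_self n)
  obtain ⟨⟨g, hg⟩, hsub⟩ := hT' (B n) n ⟨f, fun p hp => by
    rw [hn] at hp
    exact hfT p (Finset.mem_filter.1 hp).1⟩
  have hh : A.piecewise g f ∈ ratBox (T' (B n) n) := fun p hp => by
    rw [piecewise_eq_of_mem _ _ _ (hsupp _ hBn n p hp)]
    exact hg p hp
  -- On `A` the point follows `g`, hence lies in the selected set; off `A` it follows `f`, which
  -- satisfies the constraints of `T` there.
  refine ⟨A.piecewise g f, hTO fun p hp => ?_, _, ⟨n, rfl⟩, (hsub hh).1⟩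
  by_cases hpA : p.1 ∈ A
  · rw [piecewise_eq_of_mem _ _ _ hpA]
    exact (hsub hg).2 p (hn ▸ Finset.mem_filter.2 ⟨hp, hpA⟩)
  · rw [piecewise_eq_of_notMem _ _ _ hpA]
    exact hfT p hp

theorem dense_countable_support : Dense {f : X → ℝ | (Function.support f).Countable} := by
  classical
  refine dense_iff_inter_open.2 ?_
  rintro O hO ⟨f, hf⟩
  obtain ⟨I, u, hu, hsub⟩ := isOpen_pi_iff.1 hO f hf
  refine ⟨(I : Set X).piecewise f 0, hsub fun a ha => ?_, ?_⟩
  · rw [piecewise_eq_of_mem _ _ _ ha]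
    exact (hu a ha).2
  · refine I.finite_toSet.countable.mono fun a ha => ?_
    by_contra hn
    exact ha (piecewise_eq_of_notMem _ _ _ hn)

/-- A countable set of countably supported functions vanishes entirely at some coordinate `x`, so it
misses the open set `f x > 0` and is not dense. -/
theorem not_sFin_D_D_real_power [Uncountable X] : ¬ SFin (D (X → ℝ)) (D (X → ℝ)) := by
  intro h
  obtain ⟨C, hC, hcount, hd⟩ := h.exists_countable_dense_subset dense_countable_support
  have hA : (⋃ f ∈ C, Function.support f).Countable := hcount.biUnion fun f hf => hC hf
  obtain ⟨x, hx⟩ : ∃ x, x ∉ ⋃ f ∈ C, Function.support f := by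
    by_contra! hall
    exact not_countable_univ (hA.mono fun x _ => hall x)
  obtain ⟨f, hf, hfC⟩ := hd.inter_open_nonempty ((fun f : X → ℝ => f x) ⁻¹' Ioi 0)
    (isOpen_Ioi.preimage (continuous_apply x)) ⟨fun _ => 1, by simp⟩
  exact hx (mem_biUnion hfC (ne_of_gt hf))

theorem refutes_real_power [Uncountable X] : Refutes (X → ℝ) .oneDoD .finDD :=
  ⟨sOne_Do_D_real_power, not_sFin_D_D_real_power⟩

end RealPower

/-! ### Successor ordinals -/

section SuccessorOrdinal

variable {α : Ordinal.{u}}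

instance : Nonempty (Iio (α + 1)) := ⟨⟨α, mem_Iio.2 (Order.lt_add_one_iff.2 le_rfl)⟩⟩

/-- Induction on `β` covers the points up to `β`: the member of the first cover containing `β`
contains some `(l, β]`, and the remaining covers handle the points up to `l < β`. The claim
therefore quantifies over all sequences of covers, so that it applies to the shifted one. -/
theorem sOne_Op_Op_ordinal : SOne (Op (Iio (α + 1))) (Op (Iio (α + 1))) := by
  suffices H : ∀ β < α + 1, ∀ 𝒰 : ℕ → Set (Set (Iio (α + 1))), (∀ n, 𝒰 n ∈ Op _) →
      ∃ U : ℕ → Set (Iio (α + 1)), (∀ n, U n ∈ 𝒰 n) ∧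
        ∀ x : Iio (α + 1), x.1 ≤ β → x ∈ ⋃ n, U n by
    intro 𝒰 h𝒰
    obtain ⟨U, hU, hc⟩ := H α (Order.lt_add_one_iff.2 le_rfl) 𝒰 h𝒰
    refine ⟨U, hU, eq_univ_of_forall fun x => ?_, ?_⟩
    · rw [sUnion_range]
      exact hc x (Order.lt_add_one_iff.1 x.2)
    · rintro _ ⟨n, rfl⟩
      exact (h𝒰 n).2 _ (hU n)
  intro β
  induction β using WellFoundedLT.induction with
  | ind β ih =>
  intro hβ 𝒰 h𝒰
  obtain ⟨U₀, hU₀, hβU⟩ : (⟨β, hβ⟩ : Iio (α + 1)) ∈ ⋃₀ 𝒰 0 := by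
    rw [(h𝒰 0).1]
    trivial
  obtain ⟨V, hV, rfl⟩ := isOpen_induced_iff.1 ((h𝒰 0).2 U₀ hU₀)
  have cons : ∀ U' : ℕ → Set (Iio (α + 1)), (∀ n, U' n ∈ 𝒰 (n + 1)) →
      (∀ x : Iio (α + 1), x.1 ≤ β → x.1 ∈ V ∨ x ∈ ⋃ n, U' n) →
      ∃ U : ℕ → Set (Iio (α + 1)), (∀ n, U n ∈ 𝒰 n) ∧
        ∀ x : Iio (α + 1), x.1 ≤ β → x ∈ ⋃ n, U n := by
    intro U' hU' hcov
    refine ⟨fun n => Nat.casesOn n (Subtype.val ⁻¹' V) U', fun n => ?_, fun x hx => ?_⟩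
    · cases n with
      | zero => exact hU₀
      | succ n => exact hU' n
    · rcases hcov x hx with h | h
      · exact mem_iUnion.2 ⟨0, h⟩
      · obtain ⟨n, hn⟩ := mem_iUnion.1 h
        exact mem_iUnion.2 ⟨n + 1, hn⟩
  by_cases h0 : ∃ l, l < β
  · obtain ⟨l, hl, hsub⟩ := exists_Ioc_subset_of_mem_nhds (hV.mem_nhds hβU) h0
    obtain ⟨U', hU', hcov⟩ := ih l hl (hl.trans hβ) (fun n => 𝒰 (n + 1)) fun n => h𝒰 (n + 1)
    refine cons U' hU' fun x hx => ?_
    rcases le_or_gt x.1 l with h | h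
    · exact Or.inr (hcov x h)
    · exact Or.inl (hsub ⟨h, hx⟩)
  · push Not at h0
    have hne : ∀ n, (𝒰 (n + 1)).Nonempty := fun n =>
      nonempty_of_mem_D (Op_subset_D (h𝒰 (n + 1)))
    choose U' hU' using hne
    refine cons U' hU' fun x hx => Or.inl ?_
    rw [le_antisymm hx (h0 _)]
    exact hβU

theorem isOpen_singleton_Iio {β : Iio (α + 1)} (h : ¬ Order.IsSuccLimit β.1) :
    IsOpen ({β} : Set (Iio (α + 1))) := by
  have := (SuccOrder.isOpen_singleton_iff.2 h).preimage
    (continuous_subtype_val (p := (· ∈ Iio (α + 1))))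
  convert this
  ext x
  simp [Subtype.ext_iff]

/-- A neighbourhood of a limit point contains a successor, and successors are isolated. -/
theorem dense_isolated_ordinal : Dense {x : Iio (α + 1) | IsOpen ({x} : Set (Iio (α + 1)))} := by
  refine dense_iff_inter_open.2 ?_
  rintro O hO ⟨x, hx⟩
  by_cases hlim : Order.IsSuccLimit x.1
  · obtain ⟨V, hV, rfl⟩ := isOpen_induced_iff.1 hO
    obtain ⟨a, ha, hsub⟩ := SuccOrder.isOpen_iff.1 hV x.1 hx hlim
    have hlt : Order.succ a < x.1 := hlim.succ_lt ha
    exact ⟨⟨Order.succ a, hlt.trans x.2⟩, hsub ⟨Order.lt_succ a, hlt⟩,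
      isOpen_singleton_Iio fun h => h.isSuccPrelimit.succ_ne a rfl⟩
  · exact ⟨x, hx, isOpen_singleton_Iio hlim⟩

/-- Singletons of isolated points form a member of `D_o`. A dense union of selected ones contains
every isolated point, yet is countable; but the successor map injects `Iio α` into the isolated
points. -/
theorem not_sFin_Do_D_ordinal (hα : ¬ (Iio (α + 1)).Countable) :
    ¬ SFin (Do (Iio (α + 1))) (D (Iio (α + 1))) := by
  intro h
  obtain ⟨F, hF, hd⟩ := h (fun _ => {U | ∃ x, U = {x} ∧ IsOpen U}) fun _ => by
    refine ⟨dense_isolated_ordinal.mono fun x hx => ⟨{x}, ⟨x, rfl, hx⟩, rfl⟩, ?_⟩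
    rintro U ⟨x, -, hU⟩
    exact hU
  have hsing : ∀ U ∈ ⋃ n, F n, ∃ x : Iio (α + 1), U = {x} := fun U hU => by
    obtain ⟨n, hn⟩ := mem_iUnion.1 hU
    obtain ⟨x, hx, -⟩ := (hF n).2 hn
    exact ⟨x, hx⟩
  have hcount : (⋃₀ ⋃ n, F n).Countable :=
    (countable_iUnion fun n => (hF n).1.countable).sUnion fun U hU => by
      obtain ⟨x, rfl⟩ := hsing U hU
      exact countable_singleton x
  have hiso : ∀ x : Iio (α + 1), IsOpen ({x} : Set (Iio (α + 1))) → x ∈ ⋃₀ ⋃ n, F n := by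
    intro x hx
    obtain ⟨y, hy, hyF⟩ := Dense.inter_open_nonempty hd _ hx (singleton_nonempty x)
    rwa [mem_singleton_iff.1 hy] at hyF
  have hIio : (Iio α).Countable := by
    refine ((hcount.image Subtype.val).preimage_of_injOn
      (f := Order.succ) Order.succ_injective.injOn).mono fun β hβ => ?_
    have hlt : Order.succ β < α + 1 :=
      Order.lt_add_one_iff.2 (Order.succ_le_of_lt hβ)
    exact ⟨⟨Order.succ β, hlt⟩, hiso _ (isOpen_singleton_Iio fun h =>
      h.isSuccPrelimit.succ_ne β rfl), rfl⟩
  refine hα ((hIio.insert α).mono fun β hβ => ?_)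
  exact (Order.lt_add_one_iff.1 hβ).eq_or_lt

theorem refutes_ordinal (hα : ¬ (Iio (α + 1)).Countable) :
    Refutes (Iio (α + 1)) .oneOpOp .finDoD :=
  ⟨sOne_Op_Op_ordinal, not_sFin_Do_D_ordinal hα⟩

end SuccessorOrdinal

/-! ### The remainder of `βℕ` -/

theorem isOpen_range_pure : IsOpen (range (pure : ℕ → Ultrafilter ℕ)) := by
  have : range (pure : ℕ → Ultrafilter ℕ) = ⋃ n : ℕ, {u : Ultrafilter ℕ | {n} ∈ u} := by
    ext u
    simp only [mem_range, mem_iUnion, mem_ofPred_eq]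
    refine exists_congr fun n => ⟨fun h => ?_, fun h => ?_⟩
    · rw [← h]
      exact Ultrafilter.mem_pure.2 rfl
    · obtain ⟨m, hm, rfl⟩ := Ultrafilter.eq_pure_of_finite_mem (finite_singleton n) h
      rw [mem_singleton_iff.1 hm]
  rw [this]
  exact isOpen_iUnion fun n => ultrafilter_isOpen_basic _

instance : CompactSpace BetaNRemainder :=
  isCompact_iff_compactSpace.1 isOpen_range_pure.isClosed_compl.isCompact

theorem exists_betaNRemainder_mem {B : Set ℕ} (hB : B.Infinite) :
    ∃ u : BetaNRemainder, B ∈ u.1 := by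
  have : (cofinite ⊓ 𝓟 B).NeBot := hB.cofinite_inf_principal_neBot
  have hle := Ultrafilter.of_le (cofinite ⊓ 𝓟 B)
  refine ⟨⟨Ultrafilter.of (cofinite ⊓ 𝓟 B), ?_⟩, hle (mem_inf_of_right (mem_principal_self B))⟩
  rintro ⟨n, hn⟩
  have h1 : ({n} : Set ℕ)ᶜ ∈ Ultrafilter.of (cofinite ⊓ 𝓟 B) :=
    hle (mem_inf_of_left (finite_singleton n).compl_mem_cofinite)
  rw [← hn] at h1
  exact Ultrafilter.mem_pure.1 h1 rfl

theorem infinite_of_mem_betaNRemainder (u : BetaNRemainder) {B : Set ℕ} (hB : B ∈ u.1) :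
    B.Infinite := fun hfin => by
  obtain ⟨n, -, hn⟩ := Ultrafilter.eq_pure_of_finite_mem hfin hB
  exact u.2 ⟨n, hn.symm⟩

instance : Nonempty BetaNRemainder :=
  let ⟨u, _⟩ := exists_betaNRemainder_mem infinite_univ
  ⟨u⟩

/-- Identify `ℕ` with the finite binary sequences and let the n-th cover split by the n-th bit. If
bits `f n` are selected, the initial segments `s m` of the complementary sequence form an infinite
set that meets each `A n (f n)` only in some `s m` with `m ≤ n`. The ultrafilters containing this
set thus form a nonempty open set missed by the selection. -/
theorem not_sOne_Op_D_betaNRemainder : ¬ SOne (Op BetaNRemainder) (D BetaNRemainder) := by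
  intro h
  obtain ⟨e⟩ : Nonempty (List Bool ≃ ℕ) := nonempty_equiv_of_countable
  -- Sequences too short to have an n-th bit get the default `false`, so the two sets cover `ℕ`.
  let A : ℕ → Bool → Set ℕ := fun n b => {k | (e.symm k).getD n false = b}
  obtain ⟨U, hU, hd⟩ := h (fun n => range fun b => {u : BetaNRemainder | A n b ∈ u.1}) fun n => by
    refine ⟨eq_univ_of_forall fun u => ?_, ?_⟩
    · have : A n true ∪ A n false ∈ u.1 := by
        refine mem_of_superset univ_mem fun k _ => ?_
        cases hk : (e.symm k).getD n false <;> simp [A, -List.getD_eq_getElem?_getD, hk]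
      rcases Ultrafilter.union_mem_iff.1 this with h | h
      · exact ⟨_, ⟨true, rfl⟩, h⟩
      · exact ⟨_, ⟨false, rfl⟩, h⟩
    · rintro _ ⟨b, rfl⟩
      exact (ultrafilter_isOpen_basic (A n b)).preimage continuous_subtype_val
  choose f hf using hU
  let s : ℕ → List Bool := fun m => List.ofFn fun i : Fin m => !f i
  have hs : Function.Injective fun m => e (s m) := fun m n hmn => by
    have := congrArg List.length (e.injective hmn)
    simpa [s] using this
  obtain ⟨u₀, hu₀⟩ := exists_betaNRemainder_mem (infinite_range_of_injective hs)
  obtain ⟨u, hu, V, ⟨n, rfl⟩, huV⟩ := Dense.inter_open_nonempty hd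
    {u : BetaNRemainder | (range fun m => e (s m)) ∈ u.1}
    ((ultrafilter_isOpen_basic _).preimage continuous_subtype_val) ⟨u₀, hu₀⟩
  rw [← hf n] at huV
  refine infinite_of_mem_betaNRemainder u (inter_mem hu huV)
    (((finite_Iic n).image fun m => e (s m)).subset ?_)
  rintro _ ⟨⟨m, rfl⟩, hm⟩
  refine ⟨m, ?_, rfl⟩
  by_contra hlt
  have hlt : n < m := not_le.1 hlt
  simp [A, s, hlt] at hm

theorem refutes_betaNRemainder : Refutes BetaNRemainder .finOpOp .oneOpD :=
  ⟨sFin_Op_Op_of_compact, not_sOne_Op_D_betaNRemainder⟩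

end DenseFamilies

namespace DenseFamilies

open Set Topology MeasureTheory

/-! ### Pixley–Roy spaces -/

namespace PixleyRoy

variable {X : Type u}

theorem mem_basic_self {F : PixleyRoy X} {U : Set X} (h : (F.1 : Set X) ⊆ U) :
    F ∈ basic F U := ⟨subset_rfl, h⟩

/-- The point of the Pixley–Roy space given by a nonempty tuple. -/
noncomputable def ofTuple {j : ℕ} (g : Fin (j + 1) → X) : PixleyRoy X :=
  open scoped Classical in ⟨Finset.univ.image g, Finset.univ_nonempty.image g⟩

theorem mem_ofTuple {j : ℕ} {g : Fin (j + 1) → X} {x : X} :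
    x ∈ (ofTuple g).1 ↔ ∃ i, g i = x := by
  simp [ofTuple]

theorem exists_ofTuple_eq (F : PixleyRoy X) : ∃ (j : ℕ) (g : Fin (j + 1) → X), ofTuple g = F := by
  obtain ⟨n, g, -, hg⟩ := F.1.finite_toSet.fin_param
  cases n with
  | zero =>
    obtain ⟨x, hx⟩ := F.2
    obtain ⟨i, -⟩ := hg.ge hx
    exact i.elim0
  | succ j =>
    refine ⟨j, g, Subtype.ext (Finset.ext fun x => ?_)⟩
    rw [mem_ofTuple]
    exact Set.ext_iff.1 hg x

instance [Countable X] : Countable (PixleyRoy X) :=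
  inferInstanceAs (Countable {F : Finset X // F.Nonempty})

instance [Nonempty X] : Nonempty (PixleyRoy X) :=
  ⟨⟨{Classical.arbitrary X}, Finset.singleton_nonempty _⟩⟩

variable [TopologicalSpace X]

theorem isOpen_basic (F : PixleyRoy X) {U : Set X} (hU : IsOpen U) : IsOpen (basic F U) :=
  TopologicalSpace.isOpen_generateFrom_of_mem ⟨F, U, hU, rfl⟩

/-- Basic sets can be recentred: `G ∈ [F, U]` gives `[G, U] ⊆ [F, U]`. Hence the sets `[F, U]` with
`F ⊆ U` form a local base at `F`. -/
theorem isOpen_iff {O : Set (PixleyRoy X)} :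
    IsOpen O ↔ ∀ F ∈ O, ∃ U, IsOpen U ∧ (F.1 : Set X) ⊆ U ∧ basic F U ⊆ O := by
  refine ⟨fun hO => ?_, fun h => isOpen_iff_mem_nhds.2 fun F hF => ?_⟩
  · induction hO with
    | basic B hB =>
      obtain ⟨F, U, hU, rfl⟩ := hB
      exact fun G hG => ⟨U, hU, hG.2, fun H hH => ⟨hG.1.trans hH.1, hH.2⟩⟩
    | univ => exact fun F _ => ⟨univ, isOpen_univ, subset_univ _, subset_univ _⟩
    | inter s t _ _ hs ht =>
      intro F hF
      obtain ⟨U, hU, hFU, hUs⟩ := hs F hF.1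
      obtain ⟨V, hV, hFV, hVt⟩ := ht F hF.2
      exact ⟨U ∩ V, hU.inter hV, subset_inter hFU hFV, fun H hH =>
        ⟨hUs ⟨hH.1, hH.2.trans inter_subset_left⟩, hVt ⟨hH.1, hH.2.trans inter_subset_right⟩⟩⟩
    | sUnion S _ ih =>
      rintro F ⟨s, hs, hF⟩
      obtain ⟨U, hU, hFU, hUs⟩ := ih s hs F hF
      exact ⟨U, hU, hFU, hUs.trans (subset_sUnion_of_mem hs)⟩
  · obtain ⟨U, hU, hFU, hUO⟩ := h F hF
    exact Filter.mem_of_superset ((isOpen_basic F hU).mem_nhds (mem_basic_self hFU)) hUO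

/-- If `C ⊆ V` with `C` compact and `V` open, finitely many members of a dense open family meet
all `[F, V]` where `F ⊆ C` has at most `j + 1` elements. -/
theorem exists_finite_meeting {𝒰 : Set (Set (PixleyRoy X))} (h𝒰 : 𝒰 ∈ Do (PixleyRoy X))
    {C V : Set X} (hC : IsCompact C) (hV : IsOpen V) (hCV : C ⊆ V) (j : ℕ) :
    ∃ ℱ : Set (Set (PixleyRoy X)), ℱ.Finite ∧ ℱ ⊆ 𝒰 ∧
      ∀ g : Fin (j + 1) → X, (∀ i, g i ∈ C) → ∃ O ∈ ℱ, (basic (ofTuple g) V ∩ O).Nonempty := by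
  classical
  have hK : IsCompact {g : Fin (j + 1) → X | ∀ i, g i ∈ C} := by
    convert isCompact_univ_pi fun _ : Fin (j + 1) => hC
    ext g
    simp
  have key : ∀ g : Fin (j + 1) → X, (∀ i, g i ∈ C) → ∃ O ∈ 𝒰, ∃ N ∈ 𝓝 g,
      ∀ g' ∈ N, (basic (ofTuple g') V ∩ O).Nonempty := by
    intro g hg
    have hgV : ((ofTuple g).1 : Set X) ⊆ V := fun x hx => by
      obtain ⟨i, rfl⟩ := mem_ofTuple.1 hx
      exact hCV (hg i)
    obtain ⟨G, hG, O, hO, hGO⟩ :=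
      h𝒰.1.inter_open_nonempty _ (isOpen_basic (ofTuple g) hV) ⟨_, mem_basic_self hgV⟩
    obtain ⟨W, hW, hGW, hWO⟩ := isOpen_iff.1 (h𝒰.2 O hO) G hGO
    -- If all entries of `g'` lie in `W ∩ V`, adding them to `G` stays in `[G, W] ⊆ O` and gives a
    -- point of the basic set of `g'`.
    refine ⟨O, hO, {g' | ∀ i, g' i ∈ W ∩ V}, ?_, fun g' hg' => ?_⟩
    · have : {g' : Fin (j + 1) → X | ∀ i, g' i ∈ W ∩ V} = univ.pi fun _ => W ∩ V := by
        ext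
        simp
      rw [this]
      refine (isOpen_set_pi finite_univ fun _ _ => hW.inter hV).mem_nhds fun i _ => ?_
      have hi : g i ∈ G.1 := hG.1 (mem_ofTuple.2 ⟨i, rfl⟩)
      exact ⟨hGW hi, hG.2 hi⟩
    · have hsub : ∀ x ∈ G.1 ∪ (ofTuple g').1, x ∈ W ∩ V := fun x hx => by
        rcases Finset.mem_union.1 hx with h | h
        · exact ⟨hGW h, hG.2 h⟩
        · obtain ⟨i, rfl⟩ := mem_ofTuple.1 h
          exact hg' i
      exact ⟨⟨G.1 ∪ (ofTuple g').1, G.2.mono Finset.subset_union_left⟩,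
        ⟨Finset.subset_union_right, fun x hx => (hsub x hx).2⟩,
        hWO ⟨Finset.subset_union_left, fun x hx => (hsub x hx).1⟩⟩
  choose! O hO N hN hmeet using key
  obtain ⟨t, ht, hcov⟩ := hK.elim_nhds_subcover N hN
  refine ⟨O '' t, t.finite_toSet.image O, ?_, fun g hg => ?_⟩
  · rintro _ ⟨g, hg, rfl⟩
    exact hO g (ht g hg)
  · obtain ⟨g₀, hg₀, hgN⟩ := mem_iUnion₂.1 (hcov hg)
    exact ⟨O g₀, ⟨g₀, hg₀, rfl⟩, hmeet g₀ (ht g₀ hg₀) g hgN⟩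

end PixleyRoy

/-! ### The Pixley–Roy space of the real line -/

/-- Countably many pairs of a compact set inside an open set suffice to separate finite sets from
complements of open sets. Together with the tuple length they index the tasks in
`sFin_Do_D_pixleyRoy_real`. -/
theorem exists_rat_balls {F : Finset ℝ} {U : Set ℝ} (hU : IsOpen U) (hF : (F : Set ℝ) ⊆ U) :
    ∃ (T : Finset ℚ) (N : ℕ), (∀ x ∈ F, x ∈ ⋃ q ∈ T, Metric.closedBall (q : ℝ) (1 / (N + 1))) ∧
      ⋃ q ∈ T, Metric.ball (q : ℝ) (2 / (N + 1)) ⊆ U := by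
  classical
  obtain ⟨δ, hδ, hsub⟩ := F.finite_toSet.isCompact.exists_thickening_subset_open hU hF
  -- A point of a ball of radius `2 / (N + 1)` is within `3 / (N + 1) < δ` of `F`.
  obtain ⟨N, hN⟩ := exists_nat_one_div_lt (show 0 < δ / 3 by positivity)
  have hpos : (0 : ℝ) < 1 / (N + 1) := by positivity
  have key : ∀ x : ℝ, ∃ q : ℚ, dist x q < 1 / (N + 1) := fun x => by
    obtain ⟨y, ⟨q, rfl⟩, hq⟩ := Metric.dense_iff.1 Rat.denseRange_cast x _ hpos |>.imp
      fun y hy => And.intro hy.2 hy.1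
    exact ⟨q, by rwa [dist_comm]⟩
  choose q hq using key
  refine ⟨F.image q, N, fun x hx => ?_, iUnion₂_subset fun r hr y hy => ?_⟩
  · exact mem_biUnion (Finset.mem_image_of_mem q hx) (hq x).le
  · obtain ⟨x, hx, rfl⟩ := Finset.mem_image.1 hr
    refine hsub (Metric.mem_thickening_iff.2 ⟨x, hx, ?_⟩)
    have h1 := dist_triangle y (q x) x
    have h2 := hq x
    have h3 : dist y (q x) < 2 / (N + 1) := hy
    have h4 : (2 : ℝ) / (N + 1) = 2 * (1 / (N + 1)) := by ring
    rw [dist_comm] at h2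
    linarith

theorem sFin_Do_D_pixleyRoy_real : SFin (Do (PixleyRoy ℝ)) (D (PixleyRoy ℝ)) := by
  intro 𝒰 h𝒰
  obtain ⟨p, hp⟩ := exists_surjective_nat (Finset ℚ × ℕ × ℕ)
  have key : ∀ n, ∃ ℱ : Set (Set (PixleyRoy ℝ)), ℱ.Finite ∧ ℱ ⊆ 𝒰 n ∧
      ∀ g : Fin ((p n).2.2 + 1) → ℝ,
        (∀ i, g i ∈ ⋃ q ∈ (p n).1, Metric.closedBall (q : ℝ) (1 / ((p n).2.1 + 1))) →
        ∃ O ∈ ℱ, (PixleyRoy.basic (PixleyRoy.ofTuple g)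
          (⋃ q ∈ (p n).1, Metric.ball (q : ℝ) (2 / ((p n).2.1 + 1))) ∩ O).Nonempty := fun n => by
    refine PixleyRoy.exists_finite_meeting (h𝒰 n)
      ((p n).1.isCompact_biUnion fun q _ => isCompact_closedBall _ _)
      (isOpen_biUnion fun q _ => Metric.isOpen_ball)
      (iUnion₂_mono fun q _ => Metric.closedBall_subset_ball ?_) _
    gcongr
    norm_num
  choose ℱ hfin hsub hmeet using key
  refine ⟨ℱ, fun n => ⟨hfin n, hsub n⟩, dense_iff_inter_open.2 ?_⟩
  rintro O hO ⟨F, hF⟩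
  obtain ⟨U, hU, hFU, hUO⟩ := PixleyRoy.isOpen_iff.1 hO F hF
  obtain ⟨T, N, hC, hV⟩ := exists_rat_balls hU hFU
  obtain ⟨j, g, rfl⟩ := F.exists_ofTuple_eq
  obtain ⟨n, hn⟩ := hp (T, N, j)
  have hm := hmeet n
  rw [hn] at hm
  obtain ⟨W, hW, H, hH, hHW⟩ := hm g fun i => hC _ (PixleyRoy.mem_ofTuple.2 ⟨i, rfl⟩)
  exact ⟨H, hUO ⟨hH.1, hH.2.trans hV⟩, W, mem_iUnion.2 ⟨n, hW⟩, hHW⟩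

theorem exists_notMem_iUnion_of_measure_lt {Y : Type*} [MeasurableSpace Y] {μ : Measure Y}
    {ε : ℕ → NNReal} (hε : ∑' n, (ε n : ENNReal) < 1) (hμ : 1 ≤ μ univ) {V : ℕ → Set Y}
    (hV : ∀ n, μ (V n) < ε n) : ∃ x, x ∉ ⋃ n, V n := by
  by_contra! h
  refine absurd hμ (not_le.2 ?_)
  calc μ univ = μ (⋃ n, V n) := by rw [eq_univ_of_forall h]
    _ ≤ ∑' n, μ (V n) := measure_iUnion_le V
    _ ≤ ∑' n, (ε n : ENNReal) := ENNReal.tsum_le_tsum fun n => (hV n).le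
    _ < 1 := hε

/-- Cover by sets `[F, U]` with `U` of measure below `ε n`, where the `ε n` sum to less than 1. Some
real `x` lies in no selected `U`, so `[{x}, ℝ]` misses the selection. -/
theorem not_sOne_Op_D_pixleyRoy_real : ¬ SOne (Op (PixleyRoy ℝ)) (D (PixleyRoy ℝ)) := by
  intro h
  obtain ⟨ε, hε, hsum⟩ := ENNReal.exists_pos_sum_of_countable one_ne_zero ℕ
  obtain ⟨B, hB, hd⟩ := h (fun n => {B | ∃ F U, IsOpen U ∧ volume U < ε n ∧
      B = PixleyRoy.basic F U}) fun n => by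
    refine ⟨eq_univ_of_forall fun F => ?_, ?_⟩
    · obtain ⟨U, hFU, hU, hlt⟩ := (F.1 : Set ℝ).exists_isOpen_lt_of_lt (ε n : ENNReal)
        (by rw [F.1.finite_toSet.measure_zero volume]; exact_mod_cast hε n)
      exact ⟨_, ⟨F, U, hU, hlt, rfl⟩, PixleyRoy.mem_basic_self hFU⟩
    · rintro _ ⟨F, U, hU, -, rfl⟩
      exact PixleyRoy.isOpen_basic F hU
  choose F U hU hlt hBU using hB
  obtain ⟨x, hx⟩ := exists_notMem_iUnion_of_measure_lt (μ := volume) hsum (by simp) hlt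
  obtain ⟨H, hH, _, ⟨n, rfl⟩, hHB⟩ := Dense.inter_open_nonempty hd _
    (PixleyRoy.isOpen_basic ⟨{x}, Finset.singleton_nonempty x⟩ isOpen_univ)
    ⟨_, PixleyRoy.mem_basic_self (subset_univ _)⟩
  rw [hBU n] at hHB
  exact hx (mem_iUnion.2 ⟨n, hHB.2 (hH.1 (Finset.mem_singleton_self x))⟩)

theorem refutes_pixleyRoy_real : Refutes (PixleyRoy ℝ) .finDoD .oneOpD :=
  ⟨sFin_Do_D_pixleyRoy_real, not_sOne_Op_D_pixleyRoy_real⟩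

/-! ### Pixley–Roy spaces of Cantor trees -/

section CantorTree

variable {X : Set (ℕ → Bool)}

instance : Countable (CantorTree X) :=
  Function.Injective.countable (β := Option (List Bool))
    (f := fun p => match p with
      | .node s => some s
      | .infty => none) (by rintro (_ | _) (_ | _) h <;> simp_all)

instance : Nonempty (CantorTree X) := ⟨.infty⟩

theorem CantorTree.isOpen_of_infty_notMem {U : Set (CantorTree X)} (h : .infty ∉ U) : IsOpen U :=
  fun h' => absurd h' h

theorem CantorTree.infty_mem_basic (k : ℕ) (G : Set (ℕ → Bool)) :
    .infty ∈ CantorTree.basic X k G := fun _ h => nomatch h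

theorem CantorTree.node_mem_basic {k : ℕ} {G : Set (ℕ → Bool)} {s : List Bool} :
    .node s ∈ CantorTree.basic X k G ↔ k < s.length ∧ ∀ f ∈ G, ¬ Extends f s := by
  refine ⟨fun h => ?_, ?_⟩
  · have := h s rfl
    push Not at this
    exact this
  · rintro ⟨h1, h2⟩ t ht
    cases ht
    push Not
    exact ⟨h1, h2⟩

theorem CantorTree.isOpen_basic_union (k : ℕ) {G : Set X} (hG : G.Finite)
    (F : Set (CantorTree X)) : IsOpen (CantorTree.basic X k (Subtype.val '' G) ∪ F) :=
  fun _ => ⟨k, Subtype.val '' G, hG.image _, by rintro _ ⟨f, -, rfl⟩; exact f.2,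
    subset_union_left⟩

theorem CantorTree.exists_basic_subset {U : Set (CantorTree X)} (hU : IsOpen U)
    (h : .infty ∈ U) :
    ∃ (k : ℕ) (G : Set X), G.Finite ∧ CantorTree.basic X k (Subtype.val '' G) ⊆ U := by
  obtain ⟨k, F, hF, hFX, hsub⟩ := hU h
  refine ⟨k, Subtype.val ⁻¹' F, hF.preimage Subtype.val_injective.injOn, ?_⟩
  rwa [Subtype.image_preimage_coe, inter_eq_right.2 hFX]

theorem isClopen_extends (s : List Bool) : IsClopen {f : ℕ → Bool | Extends f s} := by
  have : {f : ℕ → Bool | Extends f s} =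
      ⋂ i : Fin s.length, (fun f : ℕ → Bool => f i) ⁻¹' {s[i]} := by
    ext f
    simp only [Extends, mem_ofPred_eq, mem_iInter, mem_preimage, mem_singleton_iff]
    exact ⟨fun h i => (h i i.2).symm, fun h i hi => (h ⟨i, hi⟩).symm⟩
  rw [this]
  exact isClopen_iInter_of_finite fun i =>
    (isClopen_discrete _).preimage (continuous_apply (i : ℕ))

/-- The set of those `f` that extend no node of `H` outside `F`. -/
def avoiding (X : Set (ℕ → Bool)) (F H : PixleyRoy (CantorTree X)) : Set X :=
  {f | ∀ s, .node s ∈ H.1 → .node s ∉ F.1 → ¬ Extends f.1 s}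

theorem isOpen_avoiding (F H : PixleyRoy (CantorTree X)) : IsOpen (avoiding X F H) := by
  have : avoiding X F H = ⋂ p ∈ H.1, {f : X | ∀ s, p = .node s → .node s ∉ F.1 →
      ¬ Extends f.1 s} := by
    ext f
    simp only [avoiding, mem_ofPred_eq, mem_iInter]
    exact ⟨fun h p hp s hs => h s (hs ▸ hp), fun h s hs => h _ hs s rfl⟩
  rw [this]
  refine isOpen_biInter_finset fun p _ => ?_
  cases p with
  | infty => simp
  | node s =>
    by_cases hs : CantorTree.node s ∈ F.1
    · simp [hs]
    · convert (isClopen_extends s).compl.isOpen.preimage (continuous_subtype_val (p := (· ∈ X)))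
      ext f
      simp [hs]

/-- A tail of a selection from sequences in `Ω` still captures every finite set. -/
theorem exists_ge_subset_of_iUnion_mem_Omega {Y : Type*} [TopologicalSpace Y]
    {ℱ : ℕ → Set (Set Y)} (hfin : ∀ n, (ℱ n).Finite) (hℱ : ⋃ n, ℱ n ∈ Omega Y) (k : ℕ)
    {G : Set Y} (hG : G.Finite) : ∃ n ≥ k, ∃ W ∈ ℱ n, G ⊆ W := by
  obtain ⟨W₀, hW₀, -⟩ := hℱ.2.2 ∅ finite_empty
  have key : ∀ W ∈ ⋃ n, ℱ n, ∃ x, x ∉ W := fun W hW => by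
    by_contra! h
    exact hℱ.2.1 (eq_univ_of_forall h ▸ hW)
  have : Nonempty Y := ⟨(key W₀ hW₀).choose⟩
  choose! x hx using key
  -- Adding to `G` a point outside each member of the first `k` families forces `W` to come from a
  -- later one.
  obtain ⟨W, hW, hsub⟩ := hℱ.2.2 (G ∪ ⋃ n ∈ Iio k, x '' ℱ n)
    (hG.union ((finite_Iio k).biUnion fun n _ => (hfin n).image x))
  obtain ⟨n, hn⟩ := mem_iUnion.1 hW
  refine ⟨n, ?_, W, hn, subset_union_left.trans hsub⟩
  by_contra! hlt
  exact hx W hW (hsub (Or.inr (mem_biUnion (mem_Iio.2 hlt) ⟨W, hn, rfl⟩)))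

/-- If `∞ ∉ F`, then `F` is isolated and lies in every dense set. Otherwise the sets `avoiding X F
H`, for suitable `H` in the n-th dense set, capture all finite subsets of `X`, and selecting among
them by `S_fin(Ω, Ω)` brings the corresponding `H` into every neighbourhood of `F`. -/
theorem sFin_D_D_pixleyRoy_cantorTree (h : SFin (Omega X) (Omega X)) :
    SFin (D (PixleyRoy (CantorTree X))) (D (PixleyRoy (CantorTree X))) := by
  classical
  refine sFin_D_D_of_countable fun F A hA => ?_
  by_cases hF : CantorTree.infty ∈ F.1
  swap
  · refine ⟨fun _ => {F}, fun n => ⟨finite_singleton F, ?_⟩,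
      subset_closure (mem_iUnion.2 ⟨0, rfl⟩)⟩
    obtain ⟨H, hH, hHA⟩ := (hA n).inter_open_nonempty _
      (PixleyRoy.isOpen_basic F (CantorTree.isOpen_of_infty_notMem (U := F.1) hF))
      ⟨F, PixleyRoy.mem_basic_self subset_rfl⟩
    rwa [singleton_subset_iff,
      show F = H from Subtype.ext (Finset.Subset.antisymm hH.1 (Finset.coe_subset.1 hH.2))]
  -- New nodes are longer than `n`, so the length condition of a neighbourhood given by `k` holds
  -- for all `n ≥ k`.
  let S : ℕ → Set (PixleyRoy (CantorTree X)) := fun n =>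
    {H | H ∈ A n ∧ F.1 ⊆ H.1 ∧ ∀ s, .node s ∈ H.1 → .node s ∉ F.1 → n < s.length}
  have hcov : ∀ n (G : Set X), G.Finite → ∃ H ∈ S n, G ⊆ avoiding X F H := by
    intro n G hG
    obtain ⟨H, hH, hHA⟩ := (hA n).inter_open_nonempty _
      (PixleyRoy.isOpen_basic F (CantorTree.isOpen_basic_union n hG F.1))
      ⟨F, PixleyRoy.mem_basic_self subset_union_right⟩
    have hnode : ∀ s, .node s ∈ H.1 → .node s ∉ F.1 →
        n < s.length ∧ ∀ f ∈ Subtype.val '' G, ¬ Extends f s := fun s hs hsF =>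
      CantorTree.node_mem_basic.1 ((hH.2 hs).resolve_right hsF)
    exact ⟨H, ⟨hHA, hH.1, fun s hs hsF => (hnode s hs hsF).1⟩,
      fun f hf s hs hsF => (hnode s hs hsF).2 f ⟨f, hf, rfl⟩⟩
  have hcl : ∀ E : ℕ → Set (PixleyRoy (CantorTree X)), (∀ n, E n ⊆ S n) →
      (∀ k (G : Set X), G.Finite → ∃ n ≥ k, ∃ H ∈ E n, G ⊆ avoiding X F H) →
      F ∈ closure (⋃ n, E n) := by
    intro E hE hEcov
    refine mem_closure_iff.2 fun O hO hFO => ?_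
    obtain ⟨U, hU, hFU, hUO⟩ := PixleyRoy.isOpen_iff.1 hO F hFO
    obtain ⟨k, G, hG, hsub⟩ := CantorTree.exists_basic_subset hU (hFU hF)
    obtain ⟨n, hn, H, hH, hGH⟩ := hEcov k G hG
    refine ⟨H, hUO ⟨(hE n hH).2.1, fun p hp => ?_⟩, mem_iUnion.2 ⟨n, hH⟩⟩
    by_cases hpF : p ∈ F.1
    · exact hFU hpF
    cases p with
    | infty => exact absurd hF hpF
    | node s =>
      refine hsub (CantorTree.node_mem_basic.2
        ⟨lt_of_le_of_lt hn ((hE n hH).2.2 s hp hpF), ?_⟩)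
      rintro _ ⟨f, hf, rfl⟩
      exact hGH hf s hp hpF
  -- Members of `Ω` must not contain the whole space. If `avoiding X F H` is everything for
  -- arbitrarily large `n`, such `H` alone suffice; otherwise the families lie in `Ω` from some `N`
  -- on.
  by_cases hfull : ∀ N, ∃ n ≥ N, ∃ H ∈ S n, avoiding X F H = univ
  · have key : ∀ n, ∃ E : Set (PixleyRoy (CantorTree X)), E.Finite ∧ E ⊆ S n ∧
        ((∃ H ∈ S n, avoiding X F H = univ) → ∃ H ∈ E, avoiding X F H = univ) := fun n => by
      by_cases hn : ∃ H ∈ S n, avoiding X F H = univ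
      · obtain ⟨H, hH, hHu⟩ := hn
        exact ⟨{H}, finite_singleton H, singleton_subset_iff.2 hH, fun _ => ⟨H, rfl, hHu⟩⟩
      · exact ⟨∅, finite_empty, empty_subset _, fun h => absurd h hn⟩
    choose E hfin hES hEu using key
    refine ⟨E, fun n => ⟨hfin n, (hES n).trans fun H hH => hH.1⟩, hcl E hES fun k G _ => ?_⟩
    obtain ⟨n, hn, hex⟩ := hfull k
    obtain ⟨H, hH, hHu⟩ := hEu n hex
    exact ⟨n, hn, H, hH, hHu ▸ subset_univ G⟩
  · push Not at hfull
    obtain ⟨N, hN⟩ := hfull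
    obtain ⟨ℱ, hℱ, hΩ⟩ := h (fun m => avoiding X F '' S (N + m)) fun m => by
      refine ⟨⟨eq_univ_of_forall fun x => ?_, ?_⟩, ?_, fun G hG => ?_⟩
      · obtain ⟨H, hH, hx⟩ := hcov (N + m) {x} (finite_singleton x)
        exact ⟨_, ⟨H, hH, rfl⟩, hx rfl⟩
      · rintro _ ⟨H, -, rfl⟩
        exact isOpen_avoiding F H
      · rintro ⟨H, hH, hHu⟩
        exact hN _ (Nat.le_add_right N m) H hH hHu
      · obtain ⟨H, hH, hGH⟩ := hcov (N + m) G hG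
        exact ⟨_, ⟨H, hH, rfl⟩, hGH⟩
    choose! η hη hηW using fun m W (hW : W ∈ ℱ m) => (hℱ m).2 hW
    let E : ℕ → Set (PixleyRoy (CantorTree X)) := fun n =>
      if N ≤ n then η (n - N) '' ℱ (n - N) else ∅
    have hES : ∀ n, E n ⊆ S n := fun n => by
      by_cases hn : N ≤ n
      · simp only [E, hn, if_true]
        rintro _ ⟨W, hW, rfl⟩
        have := hη _ W hW
        rwa [Nat.add_sub_cancel' hn] at this
      · simp [E, hn]
    refine ⟨E, fun n => ⟨?_, (hES n).trans fun H hH => hH.1⟩, hcl E hES fun k G hG => ?_⟩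
    · by_cases hn : N ≤ n
      · simpa only [E, hn, if_true] using (hℱ _).1.image _
      · simp [E, hn]
    · obtain ⟨m, hm, W, hW, hGW⟩ :=
        exists_ge_subset_of_iUnion_mem_Omega (fun m => (hℱ m).1) hΩ k hG
      refine ⟨N + m, by omega, η m W, ?_, (hηW m W hW).symm ▸ hGW⟩
      simpa [E] using mem_image_of_mem (η m) hW

/-- A finite subset of an open set has a neighbourhood inside it whose complement is described by
finitely many long nodes. -/
theorem exists_nodes {U : Set X} (hU : IsOpen U) {G : Set X} (hG : G.Finite) (hGU : G ⊆ U)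
    (k : ℕ) : ∃ S : Finset (List Bool), (∀ s ∈ S, k < s.length ∧ ∀ g ∈ G, ¬ Extends g.1 s) ∧
      ∀ f : X, (∀ s ∈ S, ¬ Extends f.1 s) → f ∈ U := by
  classical
  obtain ⟨V, hV, rfl⟩ := isOpen_induced_iff.1 hU
  have key : ∀ g ∈ G, ∃ m : ℕ, ∀ f : ℕ → Bool, (∀ i < m, f i = g.1 i) → f ∈ V := by
    intro g hg
    obtain ⟨I, u, hu, hsub⟩ := isOpen_pi_iff.1 hV g.1 (hGU hg)
    refine ⟨I.sup id + 1, fun f hf => hsub fun i hi => ?_⟩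
    rw [hf i (Nat.lt_succ_of_le (Finset.le_sup (f := id) hi))]
    exact (hu i hi).2
  choose! m hm using key
  obtain ⟨M, hkM, hM⟩ : ∃ M, k < M ∧ ∀ g ∈ G, m g ≤ M := by
    obtain ⟨B, hB⟩ := (hG.image m).bddAbove
    exact ⟨max (k + 1) B, by simp, fun g hg => (hB ⟨g, hg, rfl⟩).trans (le_max_right _ _)⟩
  -- These are the nodes of length `M` off the branches in `G`; a branch extending none of them
  -- agrees with some `g ∈ G` up to `M`.
  refine ⟨((Finset.univ : Finset (Fin M → Bool)).image List.ofFn).filter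
    fun s => ∀ g ∈ G, ¬ Extends g.1 s, fun s hs => ?_, fun f hf => ?_⟩
  · obtain ⟨hs1, hs2⟩ := Finset.mem_filter.1 hs
    obtain ⟨a, -, rfl⟩ := Finset.mem_image.1 hs1
    exact ⟨by simpa using hkM, hs2⟩
  · have hext : Extends f.1 (List.ofFn fun i : Fin M => f.1 i) := fun i hi => by simp
    by_contra hfV
    refine hf _ (Finset.mem_filter.2 ⟨Finset.mem_image_of_mem _ (Finset.mem_univ _),
      fun g hg hgs => hfV (hm g hg f fun i hi => ?_)⟩) hext
    have := hgs i (by simpa using hi.trans_le (hM g hg))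
    rwa [List.getElem_ofFn] at this

/-- A member `U` of the n-th cover is coded by finite sets `S` of nodes such that a branch avoiding
`S` lies in `U`; the open set for `S` requires `S ⊆ H` once `∞ ∈ H`. For finite `G`, density yields
a selected set meeting the neighbourhood of `{∞}` that excludes the nodes on `G`; so `G` avoids its
`S`, and `G ⊆ U`. -/
theorem sOne_Omega_Omega_of_pixleyRoy_cantorTree
    (h : SOne (Do (PixleyRoy (CantorTree X))) (D (PixleyRoy (CantorTree X)))) :
    SOne (Omega X) (Omega X) := by
  classical
  intro 𝒰 h𝒰
  obtain ⟨W, hW, hd⟩ := h (fun n => {W | ∃ S : Finset (List Bool), ∃ U ∈ 𝒰 n,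
      (∀ f : X, (∀ s ∈ S, ¬ Extends f.1 s) → f ∈ U) ∧
      W = {H | .infty ∈ H.1 → ∀ s ∈ S, .node s ∈ H.1}}) fun n => by
    refine ⟨dense_iff_inter_open.2 ?_, ?_⟩
    · rintro O hO ⟨H, hH⟩
      obtain ⟨V, hV, hHV, hVO⟩ := PixleyRoy.isOpen_iff.1 hO H hH
      by_cases hinf : CantorTree.infty ∈ H.1
      · obtain ⟨k, G, hG, hsub⟩ := CantorTree.exists_basic_subset hV (hHV hinf)
        obtain ⟨U, hU, hGU⟩ := (h𝒰 n).2.2 G hG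
        obtain ⟨S, hS, hSU⟩ := exists_nodes ((h𝒰 n).1.2 U hU) hG hGU k
        refine ⟨⟨H.1 ∪ S.image .node, H.2.mono Finset.subset_union_left⟩,
          hVO ⟨Finset.subset_union_left, fun p hp => ?_⟩, _, ⟨S, U, hU, hSU, rfl⟩,
          fun _ s hs => Finset.mem_union_right _ (Finset.mem_image_of_mem _ hs)⟩
        rcases Finset.mem_union.1 hp with hp | hp
        · exact hHV hp
        · obtain ⟨s, hs, rfl⟩ := Finset.mem_image.1 hp
          refine hsub (CantorTree.node_mem_basic.2 ⟨(hS s hs).1, ?_⟩)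
          rintro _ ⟨g, hg, rfl⟩
          exact (hS s hs).2 g hg
      · obtain ⟨U, hU, -⟩ := (h𝒰 n).2.2 ∅ finite_empty
        obtain ⟨S, -, hSU⟩ := exists_nodes ((h𝒰 n).1.2 U hU) finite_empty (empty_subset U) 0
        exact ⟨H, hH, _, ⟨S, U, hU, hSU, rfl⟩, fun hi => absurd hi hinf⟩
    · rintro _ ⟨S, U, hU, hSU, rfl⟩
      refine PixleyRoy.isOpen_iff.2 fun H hH => ?_
      by_cases hinf : CantorTree.infty ∈ H.1
      · exact ⟨univ, isOpen_univ, subset_univ _, fun H' hH' _ s hs => hH'.1 (hH hinf s hs)⟩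
      · exact ⟨H.1, CantorTree.isOpen_of_infty_notMem hinf, subset_rfl,
          fun H' hH' hi => absurd (hH'.2 hi) hinf⟩
  choose S U hU hSU hWS using hW
  have hfin : ∀ G : Set X, G.Finite → ∃ V ∈ range U, G ⊆ V := by
    intro G hG
    have hsing : (({.infty} : Finset (CantorTree X)) : Set (CantorTree X)) ⊆
        CantorTree.basic X 0 (Subtype.val '' G) ∪ ∅ := by
      simpa using CantorTree.infty_mem_basic 0 _
    obtain ⟨H, hH, _, ⟨n, rfl⟩, hHW⟩ := Dense.inter_open_nonempty hd _
      (PixleyRoy.isOpen_basic ⟨{.infty}, Finset.singleton_nonempty _⟩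
        (CantorTree.isOpen_basic_union 0 hG ∅)) ⟨_, PixleyRoy.mem_basic_self hsing⟩
    rw [hWS n] at hHW
    have hnode := hHW (hH.1 (Finset.mem_singleton_self _))
    refine ⟨U n, ⟨n, rfl⟩, fun g hg => hSU n g fun s hs => ?_⟩
    have hs' := hH.2 (hnode s hs)
    rw [union_empty] at hs'
    exact (CantorTree.node_mem_basic.1 hs').2 g ⟨g, hg, rfl⟩
  refine ⟨U, hU, ⟨eq_univ_of_forall fun x => ?_, ?_⟩, ?_, hfin⟩
  · obtain ⟨V, hV, hx⟩ := hfin {x} (finite_singleton x)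
    exact ⟨V, hV, hx rfl⟩
  · rintro _ ⟨n, rfl⟩
    exact (h𝒰 n).1.2 _ (hU n)
  · rintro ⟨n, hn⟩
    exact (h𝒰 n).2.1 (hn ▸ hU n)

theorem refutes_pixleyRoy_cantorTree (hfin : SFin (Omega X) (Omega X))
    (hone : ¬ SOne (Omega X) (Omega X)) :
    Refutes (PixleyRoy (CantorTree X)) .finDD .oneDoD :=
  ⟨sFin_D_D_pixleyRoy_cantorTree hfin,
    fun h => hone (sOne_Omega_Omega_of_pixleyRoy_cantorTree h)⟩

end CantorTree

/-! ### The Cantor set -/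

/-- By compactness of the n-th power, finitely many members of the n-th cover capture all n-tuples.
-/
theorem sFin_Omega_Omega_of_compact {Y : Type*} [TopologicalSpace Y] [CompactSpace Y] :
    SFin (Omega Y) (Omega Y) := by
  intro 𝒰 h𝒰
  have key : ∀ n, ∃ ℱ : Set (Set Y), ℱ.Finite ∧ ℱ ⊆ 𝒰 n ∧
      ∀ g : Fin n → Y, ∃ U ∈ ℱ, range g ⊆ U := fun n => by
    choose U hU hgU using fun g : Fin n → Y => (h𝒰 n).2.2 (range g) (finite_range g)
    obtain ⟨t, -, ht⟩ := isCompact_univ.elim_nhds_subcover (fun g => univ.pi fun _ => U g)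
      fun g _ => (isOpen_set_pi finite_univ fun _ _ => (h𝒰 n).1.2 _ (hU g)).mem_nhds
        fun i _ => hgU g (mem_range_self i)
    refine ⟨U '' t, t.finite_toSet.image U, ?_, fun g => ?_⟩
    · rintro _ ⟨g, -, rfl⟩
      exact hU g
    · obtain ⟨g₀, hg₀, hg⟩ := mem_iUnion₂.1 (ht (mem_univ g))
      exact ⟨U g₀, ⟨g₀, hg₀, rfl⟩, range_subset_iff.2 fun i => hg i (mem_univ i)⟩
  choose ℱ hfin hsub hcov using key
  have hΩ : ∀ G : Set Y, G.Finite → ∃ U ∈ ⋃ n, ℱ n, G ⊆ U := fun G hG => by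
    obtain ⟨n, g, -, rfl⟩ := hG.fin_param
    obtain ⟨U, hU, hgU⟩ := hcov n g
    exact ⟨U, mem_iUnion.2 ⟨n, hU⟩, hgU⟩
  refine ⟨ℱ, fun n => ⟨hfin n, hsub n⟩, ⟨eq_univ_of_forall fun x => ?_, fun U hU => ?_⟩,
    fun hu => ?_, hΩ⟩
  · obtain ⟨U, hU, hx⟩ := hΩ {x} (finite_singleton x)
    exact ⟨U, hU, hx rfl⟩
  · obtain ⟨n, hn⟩ := mem_iUnion.1 hU
    exact (h𝒰 n).1.2 U (hsub n hn)
  · obtain ⟨n, hn⟩ := mem_iUnion.1 hu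
    exact (h𝒰 n).2.1 (hsub n hn)

/-- Open sets of measure below `ε n` capture all finite sets, but with `∑ ε n < 1` one from each `n`
cannot cover. -/
theorem not_sOne_Omega_Omega_of_measure {Y : Type*} [TopologicalSpace Y] [MeasurableSpace Y]
    (μ : Measure Y) [μ.OuterRegular] [NullSingletonClass μ] (hμ : 1 ≤ μ univ) :
    ¬ SOne (Omega Y) (Omega Y) := by
  intro h
  obtain ⟨ε, hε, hsum⟩ := ENNReal.exists_pos_sum_of_countable one_ne_zero ℕ
  have hfin : ∀ n, ∀ G : Set Y, G.Finite → ∃ U ∈ {U | IsOpen U ∧ μ U < ε n}, G ⊆ U := by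
    intro n G hG
    obtain ⟨U, hGU, hU, hlt⟩ := G.exists_isOpen_lt_of_lt (μ := μ) (ε n : ENNReal)
      (by rw [hG.measure_zero μ]; exact_mod_cast hε n)
    exact ⟨U, ⟨hU, hlt⟩, hGU⟩
  obtain ⟨U, hU, ⟨hcov, -⟩, -⟩ := h (fun n => {U | IsOpen U ∧ μ U < ε n}) fun n => by
    refine ⟨⟨eq_univ_of_forall fun x => ?_, fun U hU => hU.1⟩, fun hu => ?_, hfin n⟩
    · obtain ⟨U, hU, hx⟩ := hfin n {x} (finite_singleton x)
      exact ⟨U, hU, hx rfl⟩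
    · exact absurd (hμ.trans_lt hu.2) (not_lt.2 ((ENNReal.le_tsum n).trans hsum.le))
  obtain ⟨x, hx⟩ := exists_notMem_iUnion_of_measure_lt hsum hμ fun n => (hU n).2
  rw [sUnion_range] at hcov
  exact hx (hcov ▸ mem_univ x)

theorem sFin_Omega_Omega_cantor : SFin (Omega (univ : Set (ℕ → Bool)))
    (Omega (univ : Set (ℕ → Bool))) :=
  have : CompactSpace (univ : Set (ℕ → Bool)) := isCompact_iff_compactSpace.1 isCompact_univ
  sFin_Omega_Omega_of_compact

/-- The uniform measure on the Cantor set. -/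
noncomputable def cantorMeasure : Measure (ℕ → Bool) :=
  Measure.infinitePi fun _ => (PMF.uniformOfFintype Bool).toMeasure

instance : IsProbabilityMeasure cantorMeasure := by
  unfold cantorMeasure
  infer_instance

instance : NullSingletonClass cantorMeasure := ⟨fun f => by
  have hle : ∀ n : ℕ, cantorMeasure {f} ≤ (2⁻¹ : ENNReal) ^ n := fun n => by
    calc cantorMeasure {f} ≤ cantorMeasure (Set.pi (Finset.range n) fun i => {f i}) :=
          measure_mono (by rintro _ rfl i -; rfl)
      _ = (2⁻¹ : ENNReal) ^ n := by
        rw [cantorMeasure, Measure.infinitePi_pi _ fun i _ => measurableSet_singleton (f i)]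
        simp
  refine le_antisymm (ge_of_tendsto' (ENNReal.tendsto_pow_atTop_nhds_zero_of_lt_one ?_) hle)
    zero_le
  exact ENNReal.inv_lt_one.2 ENNReal.one_lt_two⟩

theorem not_sOne_Omega_Omega_cantor : ¬ SOne (Omega (univ : Set (ℕ → Bool)))
    (Omega (univ : Set (ℕ → Bool))) := by
  let e := (Homeomorph.Set.univ (ℕ → Bool)).symm
  have : IsProbabilityMeasure (cantorMeasure.map e) :=
    Measure.isProbabilityMeasure_map e.continuous.measurable.aemeasurable
  have : NullSingletonClass (cantorMeasure.map e) := ⟨fun x => by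
    rw [Measure.map_apply e.continuous.measurable (measurableSet_singleton x)]
    exact (subsingleton_singleton.preimage e.injective).measure_zero _⟩
  exact not_sOne_Omega_Omega_of_measure (cantorMeasure.map e) measure_univ.ge

end DenseFamilies

namespace DenseFamilies

open Set Topology

/-! ### Completeness of the diagram -/

/-- Several examples live in a fixed universe; this moves them to the one quantified over. -/
theorem exists_small_refutes {Y : Type*} [TopologicalSpace Y] [Nonempty Y] [Small.{u} Y]
    {P Q : SelProp} (h : Refutes Y P Q) :
    ∃ (X : Type u) (_ : TopologicalSpace X) (_ : Nonempty X), Refutes X P Q := by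
  let e := equivShrink.{u} Y
  let t : TopologicalSpace (Shrink.{u} Y) := .induced e.symm inferInstance
  exact ⟨Shrink.{u} Y, t, ⟨e (Classical.arbitrary Y)⟩,
    h.of_homeomorph (e.symm.toHomeomorphOfIsInducing ⟨rfl⟩).symm⟩

theorem exists_uncountable_ordinal : ∃ α : Ordinal.{u}, ¬ (Iio (α + 1)).Countable := by
  refine ⟨Ordinal.omega 1, fun h => ?_⟩
  have h1 := (h.mono (Iio_subset_Iio (Order.le_succ (Ordinal.omega 1)))).le_aleph0
  rw [Cardinal.mk_Iio_ordinal] at h1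
  simp at h1

theorem Separated.exists_refutes {P Q : SelProp} (h : Separated P Q) :
    ∃ (X : Type u) (_ : TopologicalSpace X) (_ : Nonempty X), Refutes X P Q := by
  cases h
  · exact exists_small_refutes refutes_baire
  · exact exists_small_refutes (refutes_pixleyRoy_cantorTree (X := univ)
      sFin_Omega_Omega_cantor not_sOne_Omega_Omega_cantor)
  · exact exists_small_refutes (refutes_real_power (X := ULift.{u} ℝ))
  · exact exists_small_refutes refutes_pixleyRoy_real
  · obtain ⟨α, hα⟩ := exists_uncountable_ordinal.{u}
    exact exists_small_refutes (refutes_ordinal hα)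
  · exact exists_small_refutes refutes_betaNRemainder

theorem forall_imp_iff_reaches (P Q : SelProp) :
    (∀ (X : Type u) [TopologicalSpace X] [Nonempty X], P.Holds X → Q.Holds X) ↔
      Reaches P Q := by
  refine ⟨fun h => ?_, fun h X _ _ => h.holds⟩
  by_contra hn
  obtain ⟨P₀, Q₀, hs, hP, hQ⟩ := exists_separated_of_not_reaches hn
  obtain ⟨X, _, _, hX⟩ := hs.exists_refutes
  have := hX.of_reaches hP hQ
  exact this.2 (h X this.1)

end DenseFamilies

theorem mainTheorem1 :
    -- the implications valid in all nonempty spaces are exactly the compositions of arrows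
    (∀ P Q : DenseFamilies.SelProp,
      (∀ (X : Type u) [TopologicalSpace X] [Nonempty X], P.Holds X → Q.Holds X) ↔
        DenseFamilies.Reaches P Q) ∧
    -- every other implication is refuted by one of the six examples
    (∀ P Q : DenseFamilies.SelProp, ¬ DenseFamilies.Reaches P Q →
      DenseFamilies.Refutes (ℕ → ℕ) P Q ∨
      (∀ X : Set (ℕ → Bool),
        DenseFamilies.SFin (DenseFamilies.Omega X) (DenseFamilies.Omega X) →
        ¬ DenseFamilies.SOne (DenseFamilies.Omega X) (DenseFamilies.Omega X) →
        DenseFamilies.Refutes (DenseFamilies.PixleyRoy (DenseFamilies.CantorTree X)) P Q) ∨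
      (∀ X : Type u, Uncountable X → DenseFamilies.Refutes (X → ℝ) P Q) ∨
      DenseFamilies.Refutes (DenseFamilies.PixleyRoy ℝ) P Q ∨
      (∀ α : Ordinal.{u}, ¬ (Set.Iio (α + 1)).Countable →
        DenseFamilies.Refutes (Set.Iio (α + 1)) P Q) ∨
      DenseFamilies.Refutes DenseFamilies.BetaNRemainder P Q) ∧
    -- what each of the six examples refutes: the Baire space
    DenseFamilies.Refutes (ℕ → ℕ) .oneDD .finOpOp ∧
    -- the Pixley–Roy spaces of suitable Cantor tree spaces, e.g. for the whole Cantor set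
    (∀ X : Set (ℕ → Bool),
      DenseFamilies.SFin (DenseFamilies.Omega X) (DenseFamilies.Omega X) →
      ¬ DenseFamilies.SOne (DenseFamilies.Omega X) (DenseFamilies.Omega X) →
      DenseFamilies.Refutes (DenseFamilies.PixleyRoy (DenseFamilies.CantorTree X))
        .finDD .oneDoD) ∧
    DenseFamilies.SFin (DenseFamilies.Omega (Set.univ : Set (ℕ → Bool)))
      (DenseFamilies.Omega (Set.univ : Set (ℕ → Bool))) ∧
    ¬ DenseFamilies.SOne (DenseFamilies.Omega (Set.univ : Set (ℕ → Bool)))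
      (DenseFamilies.Omega (Set.univ : Set (ℕ → Bool))) ∧
    -- the uncountable Tychonoff powers of the real line
    (∀ X : Type u, Uncountable X → DenseFamilies.Refutes (X → ℝ) .oneDoD .finDD) ∧
    -- the Pixley–Roy space of the real line
    DenseFamilies.Refutes (DenseFamilies.PixleyRoy ℝ) .finDoD .oneOpD ∧
    -- the uncountable successor ordinals with the order topology
    (∀ α : Ordinal.{u}, ¬ (Set.Iio (α + 1)).Countable →
      DenseFamilies.Refutes (Set.Iio (α + 1)) .oneOpOp .finDoD) ∧
    -- the remainder of the Stone–Čech compactification of the natural numbers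
    DenseFamilies.Refutes DenseFamilies.BetaNRemainder .finOpOp .oneOpD := by
  open DenseFamilies in
  refine ⟨forall_imp_iff_reaches, fun P Q h => ?_, refutes_baire,
    fun X => refutes_pixleyRoy_cantorTree, sFin_Omega_Omega_cantor,
    not_sOne_Omega_Omega_cantor, fun X _ => refutes_real_power, refutes_pixleyRoy_real,
    fun α => refutes_ordinal, refutes_betaNRemainder⟩
  obtain ⟨P₀, Q₀, hs, hP, hQ⟩ := DenseFamilies.exists_separated_of_not_reaches h
  open DenseFamilies in
  cases hs with
  | oneDD_finOpOp => exact .inl (refutes_baire.of_reaches hP hQ)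
  | finDD_oneDoD => exact .inr (.inl fun X hfin hone =>
      (refutes_pixleyRoy_cantorTree hfin hone).of_reaches hP hQ)
  | oneDoD_finDD => exact .inr (.inr (.inl fun X _ => refutes_real_power.of_reaches hP hQ))
  | finDoD_oneOpD => exact .inr (.inr (.inr (.inl (refutes_pixleyRoy_real.of_reaches hP hQ))))
  | oneOpOp_finDoD =>
    exact .inr (.inr (.inr (.inr (.inl fun α hα => (refutes_ordinal hα).of_reaches hP hQ))))
  | finOpOp_oneOpD =>
    exact .inr (.inr (.inr (.inr (.inr (refutes_betaNRemainder.of_reaches hP hQ)))))
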